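/- Fix a countable first-order language $L$, and assume that there is an uncountable (strongly) inaccessible cardinal. A \emph{map} $f:M\to N$ between $L$-structures is an injective partial function with domain $\mathrm{dom}\,f\subseteq M$ and range in $N$ (with $M$, $N$ part of the data); it is a \emph{partial embedding} if $M\models\varphi(a)\Leftrightarrow N\models\varphi(fa)$ for every quantifier-free formula $\varphi$ and every tuple $a$ from $\mathrm{dom}\,f$, and an \emph{elementary map} if this holds for all formulas $\varphi$. It is \emph{total} if $\mathrm{dom}\,f=M$. An \emph{inductive amalgamation class} $\mathcal K$ is a category whose objects, called \emph{models}, are infinite $L$-structures, whose morphisms are partial embeddings between models, composed as partial maps, and such that: (K0) a structure elementarily equivalent to a model is a model; (K1) every elementary map between models is a morphism; (K2) the inverse $f^{-1}:N\to M$ of a morphism $f:M\to N$ is a morphism; (R) every restriction of a morphism $M\to N$ is a morphism $M\to N$; (Ap) for every morphism $f:M\to N$ there are a model $N'$ with $N\le N'$ and a total morphism $h:M\to N'$ with $f\subseteq h$, where $N\le N'$ means that $N$ is a substructure of $N'$ and the inclusion $N\to N'$ is a morphism; (In) if $\langle M_i:i<\lambda\rangle$ is a nonempty chain of models indexed by an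 ordinal, with $M_i\le M_j$ for $i<j$, then $M=\bigcup_i M_i$ is a model and $M_i\le M$ for all $i$. A model $U$ is \emph{rich} if every morphism $f:M\to U$ with $|f|<|M|\le|U|$ extends to a total morphism $M\to U$. Let $T_{\rm rich}$ be the set of sentences true in all rich models. The class $\mathcal K$ is \emph{full} if for every model $M$ the following holds: if each sentence true in $M$ is true in some rich model, then some rich model satisfies $\mathrm{Th}(M)$. A structure $M$ is \emph{saturated} if for every $A\subseteq M$ with $|A|<|M|$, every complete type over $A$ in finitely many variables is realized in $M$. A theory is \emph{model-complete} if all embeddings between its models are elementary. A theory $T'$ is a \emph{model companion} of $T$ if $T'$ is model-complete, every model of $T$ embeds in a model of $T'$, and every model of $T'$ embeds in a model of $T$. \textbf{Theorem.} Let $\mathcal K$ be an inductive amalgamation class which is axiomatized by a theory $T_0$, that is, an $L$-structure $M$ is a model of $\mathcal K$ if and only if $M\models T_0$. Assume moreover that (#) if $M$ and $N$ are models of $\mathcal K$ with $M,N\models T_{\rm rich}$, then $M\subseteq N$ (as a substructure) if and only if $M\le N$. Then the following are equivalent: 1. $T_{\rm rich}$ is model-complete; 2. $T_{\rm rich}$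 is a model companion of $T_0$; 3. all rich models are saturated and $\mathcal K$ is full. Conversely, if $T_0$ has a model companion $T_c$, then $T_{\rm rich}$ is this model companion: $T_{\rm rich}$ is a model companion of $T_0$ and it is the set of all sentences that follow from $T_c$. -/

import Mathlib

open FirstOrder FirstOrder.Language

universe u

namespace InductiveAmalgamation

/-! Partial maps between structures. Every partial embedding is injective, so a partial map
`f : M → N` is represented by a `PEquiv`, written `M ≃. N`: `f.symm` is the inverse map from `N`
to `M`, `f.trans g` is the composition, and `f ≤ g` is inclusion of graphs. -/

section Maps

variable {M N : Type u}

/-- The domain of definition of a partial map. -/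
def domain (f : M ≃. N) : Set M := {a | ∃ b, b ∈ f a}

/-- The partial map is defined everywhere. -/
def IsTotal (f : M ≃. N) : Prop := ∀ a, ∃ b, b ∈ f a

/-- An injective function as a (total) partial map. -/
noncomputable def ofInj (g : M → N) (hg : Function.Injective g) : M ≃. N where
  toFun a := some (g a)
  invFun := Function.partialInv g
  inv a b := by
    rw [hg.isPartialInv a b, Option.some_inj]

variable (L : FirstOrder.Language.{0, 0}) [L.Structure M] [L.Structure N]

/-- `M ⊨ φ(a) ↔ N ⊨ φ(f a)` for all tuples `a` in the domain of definition of `f`. -/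
def Preserves (f : M ≃. N) {n : ℕ} (φ : L.Formula (Fin n)) : Prop :=
  ∀ (x : Fin n → M) (y : Fin n → N), (∀ i, y i ∈ f (x i)) → (φ.Realize x ↔ φ.Realize y)

/-- Partial embeddings preserve all quantifier-free formulas. -/
def IsPartialEmbedding (f : M ≃. N) : Prop :=
  ∀ (n : ℕ) (φ : L.Formula (Fin n)), φ.IsQF → Preserves L f φ

/-- Elementary (partial) maps preserve all formulas. -/
def IsElementaryMap (f : M ≃. N) : Prop :=
  ∀ (n : ℕ) (φ : L.Formula (Fin n)), Preserves L f φ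

/-- The inclusion `S → T` of substructures of a common structure. -/
noncomputable def inclusionMap {L : FirstOrder.Language.{0, 0}} {M : Type u} [L.Structure M]
    {S T : L.Substructure M} (h : S ≤ T) : S ≃. T :=
  ofInj (Substructure.inclusion h) (Substructure.inclusion h).injective

/-- The inclusion `S → M` of a substructure. -/
noncomputable def subtypeMap {L : FirstOrder.Language.{0, 0}} {M : Type u} [L.Structure M]
    (S : L.Substructure M) : S ≃. M :=
  ofInj S.subtype S.subtype.injective

end Maps

/-- An inductive amalgamation class: a category of infinite `L`-structures (the models), whose
morphisms are partial embeddings and whose composition is the composition of partial maps. -/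
structure AmalgamationClass (L : FirstOrder.Language.{0, 0}) where
  /-- the objects of the category -/
  IsModel : ∀ (M : Type u) [L.Structure M], Prop
  /-- the morphisms of the category -/
  IsMor : ∀ {M N : Type u} [L.Structure M] [L.Structure N], (M ≃. N) → Prop
  infinite : ∀ {M : Type u} [L.Structure M], IsModel M → Infinite M
  isModel_of_isMor : ∀ {M N : Type u} [L.Structure M] [L.Structure N] {f : M ≃. N},
    IsMor f → IsModel M ∧ IsModel N
  isPartialEmbedding : ∀ {M N : Type u} [L.Structure M] [L.Structure N] {f : M ≃. N},
    IsMor f → IsPartialEmbedding L f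
  comp : ∀ {M N P : Type u} [L.Structure M] [L.Structure N] [L.Structure P]
    {f : M ≃. N} {g : N ≃. P}, IsMor f → IsMor g → IsMor (f.trans g)
  /-- K0: models are closed under elementary equivalence -/
  elementarilyEquivalent : ∀ {M N : Type u} [L.Structure M] [L.Structure N],
    IsModel M → (M ≅[L] N) → IsModel N
  /-- K1: elementary maps between models are morphisms; in particular identities are -/
  elementary : ∀ {M N : Type u} [L.Structure M] [L.Structure N] {f : M ≃. N},
    IsModel M → IsModel N → IsElementaryMap L f → IsMor f
  /-- K2: inverses of morphisms are morphisms -/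
  symm : ∀ {M N : Type u} [L.Structure M] [L.Structure N] {f : M ≃. N},
    IsMor f → IsMor f.symm
  /-- R: restrictions of morphisms are morphisms -/
  restrict : ∀ {M N : Type u} [L.Structure M] [L.Structure N] {f h : M ≃. N},
    IsMor h → f ≤ h → IsMor f
  /-- Ap: a morphism `f : M → N` extends to a total morphism `h : M → N'`, where `N` is a strong
  submodel of `N'` by means of the total morphism `i` -/
  amalgamation : ∀ {M N : Type u} [L.Structure M] [L.Structure N] {f : M ≃. N}, IsMor f →
    ∃ (N' : Type u) (_ : L.Structure N') (i : N ≃. N') (h : M ≃. N'),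
      IsMor i ∧ IsTotal i ∧ IsMor h ∧ IsTotal h ∧ f.trans i ≤ h
  /-- In: if `M` is the union of a nonempty well-ordered chain of models, each a strong submodel
  of the later ones, then `M` is a model and each member of the chain is a strong submodel -/
  union : ∀ {ι : Type u} [LinearOrder ι] [WellFoundedLT ι] [Nonempty ι]
    {M : Type u} [L.Structure M] (S : ι → L.Substructure M),
    (∀ i, IsModel (S i)) →
    (∀ i j, i < j → ∃ h : S i ≤ S j, IsMor (inclusionMap h)) →
    (∀ x : M, ∃ i, x ∈ S i) →
    IsModel M ∧ ∀ i, IsMor (subtypeMap (S i))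

namespace AmalgamationClass

variable {L : FirstOrder.Language.{0, 0}} (K : AmalgamationClass.{u} L)

/-- `U` is a `c`-rich model: every morphism `f : M → U` with `|f| < |M| ≤ c` extends to a total
morphism `M → U`. -/
def IsRichAt (c : Cardinal.{u}) (U : Type u) [L.Structure U] : Prop :=
  K.IsModel U ∧ ∀ (M : Type u) [L.Structure M] (f : M ≃. U), K.IsMor f →
    Cardinal.mk (domain f) < Cardinal.mk M → Cardinal.mk M ≤ c →
    ∃ h : M ≃. U, K.IsMor h ∧ IsTotal h ∧ f ≤ h

/-- `U` is a rich model, that is, `|U|`-rich. -/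
def IsRich (U : Type u) [L.Structure U] : Prop := K.IsRichAt (Cardinal.mk U) U

/-- The theory of the rich models. -/
def richTheory : L.Theory :=
  {φ | ∀ (U : Type u) [L.Structure U], K.IsRich U → U ⊨ φ}

/-- The class is full: if each sentence true in a model `M` is true in some rich model, then some
rich model satisfies the complete theory of `M`. -/
def IsFull : Prop :=
  ∀ (M : Type u) [L.Structure M], K.IsModel M →
    (∀ φ : L.Sentence, M ⊨ φ → ∃ (U : Type u) (_ : L.Structure U), K.IsRich U ∧ U ⊨ φ) →
    ∃ (U : Type u) (_ : L.Structure U), K.IsRich U ∧ U ⊨ L.completeTheory M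

/-- The models are exactly the structures satisfying `T₀`. -/
def IsAxiomatizedBy (T₀ : L.Theory) : Prop :=
  ∀ (M : Type u) [L.Structure M], K.IsModel M ↔ M ⊨ T₀

/-- The condition #: if `S` and `N` are models that satisfy the theory of the rich models and
`S` is a substructure of `N`, then `S` is a strong submodel of `N`. (The other direction of the
equivalence is part of the definition of a strong submodel.) -/
def CondSharp : Prop :=
  ∀ (N : Type u) [L.Structure N] (S : L.Substructure N),
    K.IsModel N → K.IsModel S → N ⊨ K.richTheory → S ⊨ K.richTheory → K.IsMor (subtypeMap S)

end AmalgamationClass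

section Theories

variable {L : FirstOrder.Language.{0, 0}}

/-- `M` is saturated: for `A ⊆ M` with `|A| < |M|`, every complete type in finitely many variables
over `A` (relative to the theory of `M` with names for the elements of `A`) is realized in `M`. -/
def IsSaturated (L : FirstOrder.Language.{0, 0}) (M : Type u) [L.Structure M] : Prop :=
  ∀ A : Set M, Cardinal.mk A < Cardinal.mk M →
    ∀ (n : ℕ) (p : (L[[A]].completeTheory M).CompleteType (Fin n)),
      ∃ v : Fin n → M, ∀ φ : L[[A]].Formula (Fin n), Formula.equivSentence φ ∈ p ↔ φ.Realize v

/-- `T` is model-complete: all embeddings between models of `T` are elementary. -/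
def IsModelComplete (T : L.Theory) : Prop :=
  ∀ (M N : Type u) [L.Structure M] [L.Structure N] [Nonempty M] [Nonempty N],
    M ⊨ T → N ⊨ T → ∀ f : M ↪[L] N, ∃ g : M ↪ₑ[L] N, ∀ x, g x = f x

/-- Every model of `T` embeds in a model of `T'`. -/
def ModelsEmbedIn (T T' : L.Theory) : Prop :=
  ∀ (M : Type u) [L.Structure M] [Nonempty M], M ⊨ T →
    ∃ (N : Type u) (_ : L.Structure N), N ⊨ T' ∧ Nonempty (M ↪[L] N)

/-- `T'` is a model companion of `T`: it is model-complete, every model of `T` embeds in a model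
of `T'`, and every model of `T'` embeds in a model of `T`. -/
def IsModelCompanion (T' T : L.Theory) : Prop :=
  IsModelComplete.{u} T' ∧ ModelsEmbedIn.{u} T T' ∧ ModelsEmbedIn.{u} T' T

end Theories

end InductiveAmalgamation

/-! Two facts about rich models carry the theorem. First, morphisms between rich models are
elementary, by back-and-forth (`isElementaryMap_of_isFinitelyRich`). Second, every model of size at
most an inaccessible cardinal `c` is a strong submodel of a rich one (`exists_isRich`): a chain of
length `c`, solving at each step all extension problems of size less than `c`, is long enough by
regularity, and strong inaccessibility keeps the number of problems at most `c`. Löwenheim–Skolem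
and an ultraproduct then embed every model of `T₀` in a model of the rich theory, while `T₀` itself
is true in all rich models. So the rich theory is a model companion as soon as it is model-complete.

If it is model-complete, a type over a small subset of a rich `U` is realized in a model of the rich
theory, which richness maps into `U` over the parameters, elementarily; hence `U` is saturated, and
fullness follows similarly. Conversely, fullness and saturation realize the type of any tuple from a
model of the rich theory in a rich model. Condition # makes embeddings `M → N` morphisms, so
composing links two rich models by a morphism, which is elementary.

If `T` is any model companion, embeddings alternate between countable elementary parts of rich
models and models of `T`. Both resulting chains are elementary, so the sentences of `T` pass to the
rich models (`mem_richTheory_of_models`). -/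

namespace InductiveAmalgamation

/-! ### Set-theoretic preliminaries -/

section SetTheory

open Cardinal

/-- A transfinite sequence in a preorder in which proper initial segments have upper bounds:
`N i` is obtained by `step i` from an upper bound of the earlier values. -/
theorem exists_transfinite_chain {P ι : Type*} [Preorder P] [LinearOrder ι] [WellFoundedLT ι]
    (p₀ : P) (hub : ∀ (i : ι) (c : Set.Iio i → P), Nonempty (Set.Iio i) → Monotone c →
      ∃ q, ∀ j, c j ≤ q)
    (step : ι → P → P) (hstep : ∀ i p, p ≤ step i p) :
    ∃ N : ι → P, Monotone N ∧ (∀ i, p₀ ≤ N i) ∧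
      ∀ i, ∃ q, p₀ ≤ q ∧ (∀ j < i, N j ≤ q) ∧ N i = step i q := by
  classical
  -- An upper bound above `p₀` is chosen when there is one. The default `p₀` is never needed: the
  -- induction in `main` shows that a bound exists at each stage.
  let ub : Set P → P := fun s =>
    if h : ∃ q, p₀ ≤ q ∧ ∀ x ∈ s, x ≤ q then h.choose else p₀
  let N : ι → P := (wellFounded_lt (α := ι)).fix fun i F =>
    step i (ub (Set.range fun j : Set.Iio i => F j.1 j.2))
  have hN : ∀ i, N i = step i (ub (Set.range fun j : Set.Iio i => N j.1)) := fun i =>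
    WellFounded.fix_eq _ _ _
  have hub' : ∀ s : Set P, (∃ q, p₀ ≤ q ∧ ∀ x ∈ s, x ≤ q) →
      p₀ ≤ ub s ∧ ∀ x ∈ s, x ≤ ub s := by
    intro s hs
    simp only [ub, dif_pos hs]
    exact hs.choose_spec
  have main : ∀ i, (p₀ ≤ ub (Set.range fun j : Set.Iio i => N j.1) ∧
      ∀ j < i, N j ≤ ub (Set.range fun j : Set.Iio i => N j.1)) ∧ p₀ ≤ N i ∧
      ∀ j < i, N j ≤ N i := by
    intro i
    induction i using WellFoundedLT.induction with
    | ind i ih =>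
    have hmono : Monotone fun j : Set.Iio i => N j.1 := by
      intro j k hjk
      rcases eq_or_lt_of_le hjk with h | h
      · rw [h]
      · exact (ih k.1 k.2).2.2 j.1 h
    have hq : ∃ q, p₀ ≤ q ∧ ∀ x ∈ (Set.range fun j : Set.Iio i => N j.1), x ≤ q := by
      by_cases hne : Nonempty (Set.Iio i)
      · obtain ⟨q, hq⟩ := hub i _ hne hmono
        obtain ⟨j⟩ := hne
        refine ⟨q, ((ih j.1 j.2).2.1).trans (hq j), ?_⟩
        rintro _ ⟨k, rfl⟩
        exact hq k
      · refine ⟨p₀, le_rfl, ?_⟩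
        rintro _ ⟨k, rfl⟩
        exact (hne ⟨k⟩).elim
    obtain ⟨h1, h2⟩ := hub' _ hq
    have h3 : ∀ j < i, N j ≤ ub (Set.range fun j : Set.Iio i => N j.1) :=
      fun j hj => h2 _ ⟨⟨j, hj⟩, rfl⟩
    refine ⟨⟨h1, h3⟩, ?_, fun j hj => ?_⟩
    · rw [hN]; exact h1.trans (hstep _ _)
    · rw [hN i]; exact (h3 j hj).trans (hstep _ _)
  refine ⟨N, fun i j hij => ?_, fun i => (main i).2.1, fun i => ⟨_, (main i).1.1, (main i).1.2, hN i⟩⟩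
  rcases eq_or_lt_of_le hij with h | h
  · rw [h]
  · exact (main j).2.2 i h

variable {c : Cardinal.{u}}

theorem mk_Iio_ord_lt (b : c.ord.ToType) : #(Set.Iio b) < c := by
  simpa using mk_Iio_lt b (by simp)

theorem exists_forall_lt_of_isRegular (hc : c.IsRegular) {X : Type u} (hX : #X < c)
    (g : X → c.ord.ToType) : ∃ b, ∀ x, g x < b := by
  by_contra! h
  have hcof : IsCofinal (Set.range g) := fun b => by
    obtain ⟨x, hx⟩ := h b
    exact ⟨g x, ⟨x, rfl⟩, hx⟩
  have h1 := Order.cof_le hcof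
  rw [Ordinal.cof_toType, hc.cof_ord] at h1
  exact absurd (h1.trans mk_range_le) (not_le.2 hX)

theorem power_lt_of_isStrongLimit (hc : c.IsStrongLimit) {a b : Cardinal.{u}} (ha : a < c)
    (hb : b < c) : a ^ b < c := by
  have hab : a ^ b ≤ 2 ^ (a * b) := by
    rw [power_mul]
    exact power_le_power_right (cantor a).le
  refine hab.trans_lt (hc.isStrongPrelimit (mul_lt_of_lt hc.aleph0_le ha hb))

/-- By regularity a function from fewer than `c` points to `c` is bounded, so it maps into a proper
initial segment. There are `c` segments, each receiving fewer than `c` functions. -/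
theorem power_le_of_isInaccessible (hc : c.IsInaccessible) {b : Cardinal.{u}} (hb : b < c) :
    c ^ b ≤ c := by
  induction b using Cardinal.inductionOn with
  | mk X =>
  have h : Function.Surjective
      (fun p : Σ b : c.ord.ToType, (X → Set.Iio b) => fun x => (p.2 x : c.ord.ToType)) := by
    intro g
    obtain ⟨b, hb⟩ := exists_forall_lt_of_isRegular hc.isRegular hb g
    exact ⟨⟨b, fun x => ⟨g x, hb x⟩⟩, rfl⟩
  have h1 := mk_le_of_surjective h
  have h2 : #(X → c.ord.ToType) = c ^ #X := by simp
  rw [h2, mk_sigma] at h1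
  refine h1.trans ((sum_le_mk_mul_iSup _).trans ?_)
  have h3 : #c.ord.ToType = c := by simp
  rw [h3]
  refine (mul_le_mul_right (ciSup_le' (a := c) fun b => ?_) c).trans (mul_eq_self hc.aleph0_lt.le).le
  rw [mk_pi, prod_const, lift_id, lift_id]
  exact (power_lt_of_isStrongLimit hc.isStrongLimit (mk_Iio_ord_lt b) hb).le

/-- A structure is determined by the graphs of its symbols, coded as sets of finite lists; these are
subsets of a set smaller than the strong limit `c`. -/
theorem mk_structure_lt (hc : c.IsInaccessible) (L : FirstOrder.Language.{0, 0})
    [Countable L.Symbols] {X : Type u} (hX : #X < c) : #(L.Structure X) < c := by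
  let F : Type := Σ n, L.Functions n
  let R : Type := Σ n, L.Relations n
  have hF : Countable F := (Sum.inl_injective (α := F) (β := R)).countable
  have hR : Countable R := (Sum.inr_injective (α := F) (β := R)).countable
  let enc : L.Structure X → Set (F × List X × X) × Set (R × List X) := fun s =>
    ({p | ∃ x : Fin p.1.1 → X, p.2.1 = List.ofFn x ∧ p.2.2 = s.funMap p.1.2 x},
      {p | ∃ x : Fin p.1.1 → X, p.2 = List.ofFn x ∧ s.RelMap p.1.2 x})
  have henc : Function.Injective enc := by
    intro s t hst
    have h1 := congrArg Prod.fst hst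
    have h2 := congrArg Prod.snd hst
    refine Language.Structure.ext ?_ ?_
    · funext n f x
      have : ((⟨n, f⟩ : F), List.ofFn x, s.funMap f x) ∈ (enc s).1 := ⟨x, rfl, rfl⟩
      rw [h1] at this
      obtain ⟨y, hy, hy'⟩ := this
      have hxy : x = y := List.ofFn_injective hy
      subst hxy
      exact hy'
    · funext n r x
      have : ((⟨n, r⟩ : R), List.ofFn x) ∈ (enc s).2 ↔ ((⟨n, r⟩ : R), List.ofFn x) ∈ (enc t).2 := by
        rw [h2]
      have key : ∀ s : L.Structure X, ((⟨n, r⟩ : R), List.ofFn x) ∈ (enc s).2 ↔ s.RelMap r x := by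
        intro s
        constructor
        · rintro ⟨y, hy, hy'⟩
          rw [List.ofFn_injective hy]
          exact hy'
        · intro h
          exact ⟨x, rfl, h⟩
      rw [key, key] at this
      exact propext this
  have hL : #(List X) < c := (mk_list_le_max X).trans_lt (max_lt hc.aleph0_lt hX)
  have hlift : ∀ Y : Type, Countable Y → Cardinal.lift.{u} #Y < c := fun Y hY =>
    (lift_le_aleph0.2 (mk_le_aleph0_iff.2 hY)).trans_lt hc.aleph0_lt
  refine (mk_le_of_injective henc).trans_lt ?_
  have hc0 := hc.aleph0_lt.le
  simp only [mk_prod, mk_set, lift_id, lift_uzero]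
  have h2 : ∀ {a}, a < c → 2 ^ a < c := fun h => hc.isStrongLimit.isStrongPrelimit h
  exact mul_lt_of_lt hc0 (h2 (mul_lt_of_lt hc0 (hlift F hF) (mul_lt_of_lt hc0 hL hX)))
    (h2 (mul_lt_of_lt hc0 (hlift R hR) hL))

theorem mk_pequiv_le (hc : c.IsInaccessible) {X A : Type u} (hX : #X < c) (hA : #A ≤ c) :
    #(X ≃. A) ≤ c := by
  have h : Function.Injective (fun f : X ≃. A => (f : X → Option A)) := DFunLike.coe_injective
  refine (mk_le_of_injective h).trans ?_
  have h1 : #(X → Option A) = (#A + 1) ^ #X := by simp [mk_option]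
  rw [h1]
  refine (power_le_power_right ?_).trans (power_le_of_isInaccessible hc hX)
  exact add_le_of_le hc.aleph0_lt.le hA (one_le_aleph0.trans hc.aleph0_lt.le)

theorem exists_equiv_Iio (c : Cardinal.{u}) {X : Type u} (hX : #X < c) :
    ∃ b : c.ord.ToType, Nonempty (X ≃ Set.Iio b) := by
  have h : (#X).ord < Ordinal.type (α := c.ord.ToType) (· < ·) := by
    rw [Ordinal.type_toType]
    exact ord_lt_ord.2 hX
  refine ⟨Ordinal.enum (α := c.ord.ToType) (· < ·) ⟨_, h⟩, Cardinal.eq.1 ?_⟩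
  have h2 := Ordinal.card_typein (r := ((· < ·) : c.ord.ToType → c.ord.ToType → Prop))
    (Ordinal.enum (α := c.ord.ToType) (· < ·) ⟨_, h⟩)
  rw [Ordinal.typein_enum, card_ord] at h2
  exact h2

end SetTheory

/-! ### Partial maps -/

section Maps

variable {M N P : Type u}

theorem mem_ofInj {g : M → N} {hg : Function.Injective g} {a : M} {b : N} :
    b ∈ ofInj g hg a ↔ g a = b := by
  change some (g a) = some b ↔ _
  simp

theorem isTotal_ofInj (g : M → N) (hg : Function.Injective g) : IsTotal (ofInj g hg) :=
  fun a => ⟨g a, mem_ofInj.2 rfl⟩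

theorem mem_unique {f : M ≃. N} {a : M} {b c : N} (hb : b ∈ f a) (hc : c ∈ f a) : b = c :=
  Option.mem_unique hb hc

/-- A functional and injective relation as a partial map. -/
theorem exists_pequiv_of_rel (r : M → N → Prop) (h₁ : ∀ a b c, r a b → r a c → b = c)
    (h₂ : ∀ a b c, r a c → r b c → a = b) : ∃ f : M ≃. N, ∀ a b, b ∈ f a ↔ r a b := by
  classical
  have key : ∀ {A B : Type u} (s : A → B → Prop), (∀ a b c, s a b → s a c → b = c) →
      ∀ a b, (if h : ∃ b, s a b then some h.choose else none) = some b ↔ s a b := by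
    intro A B s hs a b
    split_ifs with h
    · rw [Option.some_inj]
      exact ⟨fun e => e ▸ h.choose_spec, fun hb => hs _ _ _ h.choose_spec hb⟩
    · exact ⟨fun e => by simp at e, fun hb => (h ⟨b, hb⟩).elim⟩
  exact ⟨⟨fun a => if h : ∃ b, r a b then some h.choose else none,
    fun b => if h : ∃ a, r a b then some h.choose else none, fun a b =>
      (key (fun b a => r a b) (fun b a a' => h₂ a a' b) b a).trans (key r h₁ a b).symm⟩,
    fun a b => key r h₁ a b⟩

/-- The restriction of a partial map to a set. -/
theorem exists_restrict (f : M ≃. N) (s : Set M) :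
    ∃ g : M ≃. N, ∀ a b, b ∈ g a ↔ b ∈ f a ∧ a ∈ s :=
  exists_pequiv_of_rel (fun a b => b ∈ f a ∧ a ∈ s) (fun _ _ _ h h' => mem_unique h.1 h'.1)
    fun _ _ _ h h' => f.inj h.1 h'.1

variable {L : FirstOrder.Language.{0, 0}} [L.Structure M] [L.Structure N] [L.Structure P]

/-- Partial embeddings preserve quantifier-free formulas in an arbitrary finite set of
variables. -/
theorem IsPartialEmbedding.realize_iff {f : M ≃. N} (hf : IsPartialEmbedding L f) {α : Type*}
    [Finite α] (φ : L.Formula α) (hφ : φ.IsQF) {x : α → M} {y : α → N}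
    (h : ∀ i, y i ∈ f (x i)) : φ.Realize x ↔ φ.Realize y := by
  obtain ⟨n, ⟨e⟩⟩ := Finite.exists_equiv_fin α
  have := hf n (φ.relabel e) (hφ.relabel _) (x ∘ e.symm) (y ∘ e.symm) fun i => h _
  simpa [Formula.realize_relabel, Function.comp_assoc] using this

theorem isElementaryMap_of_elementaryEmbedding (g : M ↪ₑ[L] N) :
    IsElementaryMap L (ofInj g g.injective) := by
  intro n φ x y h
  have : y = g ∘ x := funext fun i => (mem_ofInj.1 (h i)).symm
  rw [this, g.map_formula]

theorem IsElementaryMap.trans {f : M ≃. N} {g : N ≃. P} (hf : IsElementaryMap L f)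
    (hg : IsElementaryMap L g) : IsElementaryMap L (f.trans g) := by
  intro n φ x y h
  choose z hz hz' using fun i => (PEquiv.mem_trans f g (x i) (y i)).1 (h i)
  exact (hf n φ x z hz).trans (hg n φ z y hz')

/-- A total elementary map is an elementary embedding. -/
theorem IsElementaryMap.exists_elementaryEmbedding {f : M ≃. N} (hf : IsElementaryMap L f)
    (ht : IsTotal f) : ∃ g : M ↪ₑ[L] N, ∀ a, g a ∈ f a := by
  choose g hg using ht
  exact ⟨⟨g, fun n φ x => (hf n φ x (g ∘ x) fun i => hg _).symm⟩, hg⟩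

/-- A total partial embedding is an embedding. -/
theorem IsPartialEmbedding.exists_embedding {f : M ≃. N} (hf : IsPartialEmbedding L f)
    (ht : IsTotal f) : ∃ g : M ↪[L] N, ∀ a, g a ∈ f a := by
  choose g hg using ht
  refine ⟨⟨⟨g, fun a b hab => f.inj (hg a) (hab ▸ hg b)⟩, fun {n} F x => ?_, fun {n} r x => ?_⟩, hg⟩
  · have := hf.realize_iff (Formula.graph F) (Formula.isAtomic_graph F).isQF
      (x := Fin.cons (Structure.funMap F x) x)
      (y := Fin.cons (g (Structure.funMap F x)) (g ∘ x)) (fun i => by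
        refine Fin.cases ?_ (fun i => ?_) i
        · simpa using hg _
        · simpa using hg _)
    rw [Formula.realize_graph, Formula.realize_graph] at this
    exact (this.1 rfl).symm
  · exact (hf.realize_iff (r.formula Term.var) (Relations.isQF r _) (x := x) (y := g ∘ x)
      fun i => hg _).symm

/-- An embedding into a structure corestricts to an elementary substructure that contains its
range. -/
theorem exists_codRestrict (g : M ↪[L] N)
    (S : L.ElementarySubstructure N) (h : Set.range g ⊆ S) :
    ∃ g' : M ↪[L] S, ∀ a, (g' a : N) = g a :=
  ⟨Embedding.codRestrict S.toSubstructure g fun a => h ⟨a, rfl⟩, fun _ => rfl⟩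

end Maps

/-! ### Downward Löwenheim–Skolem for countable languages -/

section LowenheimSkolem

open Cardinal

variable {L : FirstOrder.Language.{0, 0}} [Countable L.Symbols]

theorem lift_card_le {κ : Cardinal.{u}} (hκ : ℵ₀ ≤ κ) :
    Cardinal.lift.{u} L.card ≤ Cardinal.lift.{0} κ := by
  have : L.card ≤ ℵ₀ := mk_le_aleph0
  rw [lift_uzero]
  exact (lift_le_aleph0.2 this).trans hκ

/-- A set in an infinite structure lies in an elementary substructure of prescribed
cardinality. -/
theorem exists_elementarySubstructure_mk_eq {M : Type u} [L.Structure M] {κ : Cardinal.{u}}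
    (hκ : ℵ₀ ≤ κ) (s : Set M) (hs : #s ≤ κ) (hM : κ ≤ #M) :
    ∃ S : L.ElementarySubstructure M, s ⊆ S ∧ #S = κ := by
  obtain ⟨S, h1, h2⟩ := exists_elementarySubstructure_card_eq L s κ hκ (by simpa using hs)
    (lift_card_le hκ) (by simpa using hM)
  exact ⟨S, h1, by simpa using h2⟩

theorem exists_elementarySubstructure_mk_le {M : Type u} [L.Structure M] [Infinite M]
    {κ : Cardinal.{u}} (hκ : ℵ₀ ≤ κ) (s : Set M) (hs : #s ≤ κ) :
    ∃ S : L.ElementarySubstructure M, s ⊆ S ∧ #S ≤ κ := by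
  -- The bound `κ` may exceed the size of `M`, hence the minimum.
  obtain ⟨S, h1, h2⟩ := exists_elementarySubstructure_mk_eq (L := L) (κ := min κ #M)
    (le_min hκ (aleph0_le_mk M)) s (le_min hs (mk_set_le s)) (min_le_right _ _)
  exact ⟨S, h1, h2.le.trans (min_le_left _ _)⟩

end LowenheimSkolem

/-! ### Strong embeddings, amalgams and unions of chains -/

namespace AmalgamationClass

open Cardinal

variable {L : FirstOrder.Language.{0, 0}} {K : AmalgamationClass.{u} L}
variable {M N P : Type u} [L.Structure M] [L.Structure N] [L.Structure P]

variable (K) in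
/-- The embedding is a (total) morphism. -/
def IsStrong (g : M ↪[L] N) : Prop := K.IsMor (ofInj g g.injective)

theorem IsStrong.isModel_right {g : M ↪[L] N} (hg : K.IsStrong g) : K.IsModel N :=
  (K.isModel_of_isMor hg).2

theorem isMor_of_forall_mem {f h : M ≃. N} (hh : K.IsMor h) (hf : ∀ a b, b ∈ f a → b ∈ h a) :
    K.IsMor f :=
  K.restrict hh hf

theorem exists_isStrong {h : M ≃. N} (hh : K.IsMor h) (ht : IsTotal h) :
    ∃ g : M ↪[L] N, K.IsStrong g ∧ ∀ a, g a ∈ h a := by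
  obtain ⟨g, hg⟩ := (K.isPartialEmbedding hh).exists_embedding ht
  refine ⟨g, isMor_of_forall_mem hh fun a b hb => ?_, hg⟩
  rw [← mem_ofInj.1 hb]
  exact hg a

theorem IsStrong.comp {g : M ↪[L] N} {h : N ↪[L] P} (hg : K.IsStrong g) (hh : K.IsStrong h) :
    K.IsStrong (h.comp g) := by
  refine isMor_of_forall_mem (K.comp hg hh) fun a b hb => ?_
  have hb' := mem_ofInj.1 hb
  exact (PEquiv.mem_trans _ _ _ _).2 ⟨g a, mem_ofInj.2 rfl, mem_ofInj.2 hb'⟩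

theorem isModel_of_elementaryEmbedding (g : M ↪ₑ[L] N) (hN : K.IsModel N) : K.IsModel M :=
  K.elementarilyEquivalent hN g.elementarilyEquivalent.symm

theorem isModel_of_elementaryEmbedding' (g : M ↪ₑ[L] N) (hM : K.IsModel M) : K.IsModel N :=
  K.elementarilyEquivalent hM g.elementarilyEquivalent

theorem isStrong_of_elementaryEmbedding (g : M ↪ₑ[L] N) (hN : K.IsModel N) :
    K.IsStrong g.toEmbedding :=
  K.elementary (isModel_of_elementaryEmbedding g hN) hN (isElementaryMap_of_elementaryEmbedding g)

theorem isStrong_of_equiv (g : M ≃[L] N) (hM : K.IsModel M) : K.IsStrong g.toEmbedding :=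
  isStrong_of_elementaryEmbedding g.toElementaryEmbedding
    (isModel_of_elementaryEmbedding' g.toElementaryEmbedding hM)

/-- If `g = j ∘ h` and `j` is strong, then `g` strong implies `h` strong. -/
theorem IsStrong.of_comp {g : M ↪[L] P} {h : M ↪[L] N} {j : N ↪[L] P} (hg : K.IsStrong g)
    (hj : K.IsStrong j) (hgj : ∀ a, j (h a) = g a) : K.IsStrong h := by
  refine isMor_of_forall_mem (K.comp hg (K.symm hj)) fun a b hb => ?_
  refine (PEquiv.mem_trans _ _ _ _).2 ⟨g a, mem_ofInj.2 rfl, ?_⟩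
  rw [PEquiv.mem_iff_mem, ← mem_ofInj.1 hb]
  exact mem_ofInj.2 (hgj a)

theorem IsStrong.congr {g h : M ↪[L] N} (hg : K.IsStrong g) (hgh : ∀ a, g a = h a) :
    K.IsStrong h := by
  have : g = h := Embedding.ext hgh
  rwa [← this]

/-- Amalgamation, with control of the cardinality of the amalgam. -/
theorem exists_amalgam [Countable L.Symbols] {κ : Cardinal.{u}} (hκ : ℵ₀ ≤ κ) {f : M ≃. N}
    (hf : K.IsMor f) (hM : #M ≤ κ) (hN : #N ≤ κ) :
    ∃ (Q : Type u) (_ : L.Structure Q) (i : N ↪[L] Q) (h : M ↪[L] Q),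
      K.IsStrong i ∧ K.IsStrong h ∧ #Q ≤ κ ∧ ∀ a b, b ∈ f a → h a = i b := by
  obtain ⟨Q, sQ, i, h, hi, hit, hh, hht, hle⟩ := K.amalgamation hf
  obtain ⟨i', hi', hi''⟩ := exists_isStrong hi hit
  obtain ⟨h', hh', hh''⟩ := exists_isStrong hh hht
  have hQ := hi'.isModel_right
  have := K.infinite hQ
  -- An elementary substructure containing both images is again a model with strong inclusion, so
  -- both embeddings stay strong when corestricted to it.
  obtain ⟨S, hS, hScard⟩ := exists_elementarySubstructure_mk_le (L := L) hκ
    (Set.range i' ∪ Set.range h') ((mk_union_le _ _).trans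
      (add_le_of_le hκ (mk_range_le.trans hN) (mk_range_le.trans hM)))
  obtain ⟨i₁, hi₁⟩ := exists_codRestrict i' S (Set.subset_union_left.trans hS)
  obtain ⟨h₁, hh₁⟩ := exists_codRestrict h' S (Set.subset_union_right.trans hS)
  have hSs := isStrong_of_elementaryEmbedding S.subtype hQ
  refine ⟨S, inferInstance, i₁, h₁, hi'.of_comp hSs hi₁, hh'.of_comp hSs hh₁, hScard, ?_⟩
  intro a b hab
  refine Subtype.ext ?_
  rw [hi₁, hh₁]
  exact mem_unique (hh'' a) (hle _ _ ((PEquiv.mem_trans _ _ _ _).2 ⟨b, hab, hi'' b⟩))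

/-- The union of a chain of strong embeddings. -/
theorem isStrong_of_chain {ι : Type u} [LinearOrder ι] [WellFoundedLT ι] [Nonempty ι]
    {C : ι → Type u} [∀ i, L.Structure (C i)] (hC : ∀ i, K.IsModel (C i)) (e : ∀ i, C i ↪[L] M)
    (hsurj : ∀ x : M, ∃ i a, e i a = x)
    (hg : ∀ i j, i < j → ∃ g : C i ↪[L] C j, K.IsStrong g ∧ ∀ a, e j (g a) = e i a) :
    K.IsModel M ∧ ∀ i, K.IsStrong (e i) := by
  -- The union axiom speaks of substructures of one structure, so each `C i` is replaced by its
  -- image and the maps `g` are conjugated by the isomorphisms onto the images.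
  let S : ι → L.Substructure M := fun i => (e i).toHom.range
  have hS : ∀ i, K.IsStrong (e i).equivRange.toEmbedding := fun i => isStrong_of_equiv _ (hC i)
  have h := K.union S (fun i => (hS i).isModel_right) (fun i j hij => ?_) (fun x => ?_)
  · refine ⟨h.1, fun i => ?_⟩
    have h1 : K.IsStrong (S i).subtype := h.2 i
    exact ((hS i).comp h1).congr fun a => rfl
  · obtain ⟨g, hg, hge⟩ := hg i j hij
    have hle : S i ≤ S j := by
      rintro _ ⟨a, rfl⟩
      exact ⟨g a, hge a⟩
    refine ⟨hle, ?_⟩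
    refine isMor_of_forall_mem (K.comp (K.comp (K.symm (hS i)) hg) (hS j)) fun a b hab => ?_
    have hb := mem_ofInj.1 hab
    obtain ⟨a', rfl⟩ := (e i).equivRange.surjective a
    refine (PEquiv.mem_trans _ _ _ _).2
      ⟨g a', (PEquiv.mem_trans _ _ _ _).2 ⟨a', ?_, mem_ofInj.2 rfl⟩, ?_⟩
    · rw [PEquiv.mem_iff_mem]
      exact mem_ofInj.2 rfl
    · refine mem_ofInj.2 (Subtype.ext ?_)
      rw [← hb]
      exact hge a'
  · obtain ⟨i, a, rfl⟩ := hsurj x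
    exact ⟨i, a, rfl⟩

end AmalgamationClass

namespace AmalgamationClass

open Cardinal

/-! ### Morphisms between rich models are elementary -/

variable {L : FirstOrder.Language.{0, 0}} {K : AmalgamationClass.{u} L}
variable {M N U V : Type u} [L.Structure M] [L.Structure N] [L.Structure U] [L.Structure V]

/-- A morphism that extends to an elementary substructure. -/
theorem exists_isMor_extension {f : U ≃. V} (hf : K.IsMor f) (S : L.ElementarySubstructure U)
    (hS : domain f ⊆ S) (hext : ∀ f' : S ≃. V, K.IsMor f' → #(domain f') ≤ #(domain f) →
      ∃ g : S ↪[L] V, K.IsStrong g ∧ ∀ a b, b ∈ f' a → g a = b) :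
    ∃ h : U ≃. V, K.IsMor h ∧ f ≤ h ∧ domain h = S := by
  have hSs := isStrong_of_elementaryEmbedding S.subtype (K.isModel_of_isMor hf).1
  have hmem : ∀ (a : S) b, b ∈ (ofInj S.subtype S.subtype.injective).trans f a ↔ b ∈ f a := by
    intro a b
    rw [PEquiv.mem_trans]
    constructor
    · rintro ⟨c, hc, hb⟩
      rw [← mem_ofInj.1 hc] at hb
      exact hb
    · intro hb
      exact ⟨a, mem_ofInj.2 rfl, hb⟩
  obtain ⟨g, hg, hgf⟩ := hext _ (K.comp hSs hf) (by
    refine mk_le_of_injective (f := fun a => ⟨a.1.1, ?_⟩) fun a b hab => ?_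
    · obtain ⟨b, hb⟩ := a.2
      exact ⟨b, (hmem _ _).1 hb⟩
    · exact Subtype.ext (Subtype.ext (Subtype.mk.inj hab)))
  have hmem' : ∀ a b, b ∈ (ofInj S.subtype S.subtype.injective).symm.trans
      (ofInj g g.injective) a ↔ ∃ c : S, (c : U) = a ∧ g c = b := by
    intro a b
    rw [PEquiv.mem_trans]
    constructor
    · rintro ⟨c, hc, hb⟩
      rw [PEquiv.mem_iff_mem] at hc
      exact ⟨c, mem_ofInj.1 hc, mem_ofInj.1 hb⟩
    · rintro ⟨c, hc, hb⟩
      refine ⟨c, ?_, mem_ofInj.2 hb⟩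
      rw [PEquiv.mem_iff_mem]
      exact mem_ofInj.2 hc
  refine ⟨_, K.comp (K.symm hSs) hg, fun a b hab => ?_, ?_⟩
  · exact (hmem' a b).2 ⟨⟨a, hS ⟨b, hab⟩⟩, rfl, hgf _ _ ((hmem _ _).2 hab)⟩
  · ext a
    constructor
    · rintro ⟨b, hb⟩
      obtain ⟨c, rfl, -⟩ := (hmem' a b).1 hb
      exact c.2
    · intro ha
      exact ⟨g ⟨a, ha⟩, (hmem' _ _).2 ⟨⟨a, ha⟩, rfl, rfl⟩⟩

variable (K) in
/-- Finite morphisms from countable models to `U` extend to total morphisms. -/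
def IsFinitelyRich (U : Type u) [L.Structure U] : Prop :=
  K.IsModel U ∧ ∀ (M : Type u) [L.Structure M] (f : M ≃. U), K.IsMor f →
    #(domain f) < ℵ₀ → #M ≤ ℵ₀ → ∃ g : M ↪[L] U, K.IsStrong g ∧ ∀ a b, b ∈ f a → g a = b

theorem IsRich.isFinitelyRich (hU : K.IsRich U) : K.IsFinitelyRich U := by
  refine ⟨hU.1, fun M _ f hf hfin hM => ?_⟩
  have h1 := K.infinite (K.isModel_of_isMor hf).1
  have h2 := K.infinite hU.1
  obtain ⟨h, hh, ht, hle⟩ := hU.2 M f hf (hfin.trans_le (aleph0_le_mk M))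
    (hM.trans (aleph0_le_mk U))
  obtain ⟨g, hg, hgh⟩ := exists_isStrong hh ht
  exact ⟨g, hg, fun a b hab => mem_unique (hgh a) (hle _ _ hab)⟩

theorem mk_domain_symm (f : U ≃. V) : #(domain f.symm) = #(domain f) := by
  choose g hg using fun a : domain f => a.2
  refine (mk_congr (Equiv.ofBijective (fun a => ⟨g a, a.1, f.mem_iff_mem.2 (hg a)⟩) ⟨?_, ?_⟩)).symm
  · intro a b hab
    have h1 := hg a
    rw [Subtype.mk.inj hab] at h1
    exact Subtype.ext (f.inj h1 (hg b))
  · rintro ⟨b, a, ha⟩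
    rw [f.mem_iff_mem] at ha
    exact ⟨⟨a, b, ha⟩, Subtype.ext (mem_unique (hg ⟨a, b, ha⟩) ha)⟩

variable [Countable L.Symbols]

/-- The forth step: extend to a countable elementary substructure containing the domain and `c`,
then restrict so that the domain is finite again. -/
theorem IsFinitelyRich.exists_extension (hV : K.IsFinitelyRich V) {f : U ≃. V} (hf : K.IsMor f)
    (hfin : #(domain f) < ℵ₀) (c : U) :
    ∃ h : U ≃. V, K.IsMor h ∧ #(domain h) < ℵ₀ ∧ f ≤ h ∧ ∃ d, d ∈ h c := by
  have := K.infinite (K.isModel_of_isMor hf).1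
  have hfin' : #(insert c (domain f) : Set U) < ℵ₀ :=
    (mk_insert_le).trans_lt (add_lt_aleph0 hfin one_lt_aleph0)
  obtain ⟨S, hS, hScard⟩ := exists_elementarySubstructure_mk_le (L := L) le_rfl
    (insert c (domain f)) hfin'.le
  obtain ⟨h, hh, hle, hdom⟩ := exists_isMor_extension hf S ((Set.subset_insert _ _).trans hS)
    fun f' hf' hcard => hV.2 S f' hf' (hcard.trans_lt hfin) hScard
  obtain ⟨h', hh'⟩ := exists_restrict h (insert c (domain f))
  refine ⟨h', isMor_of_forall_mem hh fun a b hab => ((hh' _ _).1 hab).1, ?_, fun a b hab => ?_, ?_⟩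
  · refine (mk_le_mk_of_subset ?_).trans_lt hfin'
    rintro a ⟨b, hb⟩
    exact ((hh' _ _).1 hb).2
  · exact (hh' _ _).2 ⟨hle _ _ hab, Set.mem_insert_of_mem _ ⟨b, hab⟩⟩
  · have : c ∈ domain h := hdom ▸ hS (Set.mem_insert _ _)
    obtain ⟨d, hd⟩ := this
    exact ⟨d, (hh' _ _).2 ⟨hd, Set.mem_insert _ _⟩⟩

/-- Back-and-forth as an induction on formulas, for all finite morphisms at once. A quantifier is
handled by adding one point to `f`, or to its inverse for a point of `V`. -/
theorem realize_iff_of_isFinitelyRich (hU : K.IsFinitelyRich U) (hV : K.IsFinitelyRich V) {n m : ℕ}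
    (φ : L.BoundedFormula (Fin n) m) {f : U ≃. V} (hf : K.IsMor f) (hfin : #(domain f) < ℵ₀)
    (v : Fin n → U) (w : Fin n → V) (xs : Fin m → U) (ys : Fin m → V) (hv : ∀ i, w i ∈ f (v i))
    (hx : ∀ i, ys i ∈ f (xs i)) : φ.Realize v xs ↔ φ.Realize w ys := by
  induction φ generalizing f with
  | falsum => rfl
  | equal t₁ t₂ =>
    have := (K.isPartialEmbedding hf).realize_iff (t₁.equal t₂)
      (BoundedFormula.IsAtomic.equal _ _).isQF (x := Sum.elim v xs) (y := Sum.elim w ys)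
      (by rintro (i | i); exacts [hv i, hx i])
    rwa [Formula.realize_equal, Formula.realize_equal] at this
  | rel R ts =>
    have := (K.isPartialEmbedding hf).realize_iff (R.formula ts)
      (Relations.isQF R _) (x := Sum.elim v xs) (y := Sum.elim w ys)
      (by rintro (i | i); exacts [hv i, hx i])
    rwa [Formula.realize_rel, Formula.realize_rel] at this
  | imp φ ψ ih₁ ih₂ =>
    rw [BoundedFormula.realize_imp, BoundedFormula.realize_imp, ih₁ hf hfin xs ys hv hx,
      ih₂ hf hfin xs ys hv hx]
  | all φ ih =>
    rw [BoundedFormula.realize_all, BoundedFormula.realize_all]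
    have key : ∀ (h : U ≃. V), f ≤ h → ∀ a b, b ∈ h a → ∀ i,
        (Fin.snoc ys b : Fin _ → V) i ∈ h ((Fin.snoc xs a : Fin _ → U) i) := by
      intro h hle a b hab i
      refine Fin.lastCases ?_ (fun i => ?_) i
      · simpa using hab
      · simpa using hle _ _ (hx i)
    constructor
    · intro H b
      obtain ⟨h, hh, hhfin, hle, a, ha⟩ := hU.exists_extension (K.symm hf)
        (by rwa [mk_domain_symm]) b
      have hle' : f ≤ h.symm := fun a b hab => h.mem_iff_mem.2 (hle _ _ (f.mem_iff_mem.2 hab))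
      exact (ih (K.symm hh) (by rwa [mk_domain_symm]) _ _ (fun i => hle' _ _ (hv i))
        (key _ hle' a b (h.mem_iff_mem.2 ha))).1 (H a)
    · intro H a
      obtain ⟨h, hh, hhfin, hle, b, hb⟩ := hV.exists_extension hf hfin a
      exact (ih hh hhfin _ _ (fun i => hle _ _ (hv i)) (key _ hle a b hb)).2 (H b)

/-- Morphisms between finitely rich models are elementary. -/
theorem isElementaryMap_of_isFinitelyRich (hU : K.IsFinitelyRich U) (hV : K.IsFinitelyRich V)
    {f : U ≃. V} (hf : K.IsMor f) : IsElementaryMap L f := by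
  intro n φ x y hxy
  -- Only finitely many points matter, and a restriction of a morphism is a morphism.
  obtain ⟨h, hh⟩ := exists_restrict f (Set.range x)
  refine realize_iff_of_isFinitelyRich hU hV φ (f := h)
    (isMor_of_forall_mem hf fun a b hab => ((hh _ _).1 hab).1) ?_ x y _ _
    (fun i => (hh _ _).2 ⟨hxy i, i, rfl⟩) (fun i => i.elim0)
  refine (mk_le_mk_of_subset ?_).trans_lt (lt_aleph0_iff_set_finite.2 (Set.finite_range x))
  rintro a ⟨b, hb⟩
  exact ((hh _ _).1 hb).2

end AmalgamationClass

namespace AmalgamationClass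

open Cardinal

/-! ### Models on subsets of a fixed set -/

variable {L : FirstOrder.Language.{0, 0}} {K : AmalgamationClass.{u} L}

variable (K) in
/-- The models of cardinality at most `κ` whose universe is a subset of `Ω`. -/
structure PlacedModel (Ω : Type u) (κ : Cardinal.{u}) where
  /-- the universe of the model -/
  carrier : Set Ω
  /-- the structure on the universe -/
  str : L.Structure carrier
  isModel : K.IsModel carrier
  card_le : #carrier ≤ κ

namespace PlacedModel

variable {Ω : Type u} {κ : Cardinal.{u}}

instance (A : K.PlacedModel Ω κ) : L.Structure A.carrier := A.str

/-- `A ≤ B` if `A` is a strong submodel of `B`. -/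
instance : Preorder (K.PlacedModel Ω κ) where
  le A B := ∃ g : A.carrier ↪[L] B.carrier, K.IsStrong g ∧ ∀ a, (g a : Ω) = a
  le_refl A := ⟨Embedding.refl L _,
    isStrong_of_equiv (FirstOrder.Language.Equiv.refl L A.carrier) A.isModel, fun _ => rfl⟩
  le_trans A B C := by
    rintro ⟨g, hg, hg'⟩ ⟨h, hh, hh'⟩
    exact ⟨h.comp g, hg.comp hh, fun a => (hh' _).trans (hg' a)⟩

/-- Any two stages agree inside the later one, so symbols can be interpreted on the union at any
stage that contains the given tuple. -/
theorem exists_union (hκ : ℵ₀ ≤ κ) {ι : Type u} [LinearOrder ι] [WellFoundedLT ι] [Nonempty ι]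
    (hι : #ι ≤ κ) (c : ι → K.PlacedModel Ω κ) (hc : Monotone c) :
    ∃ B : K.PlacedModel Ω κ, B.carrier = ⋃ i, (c i).carrier ∧ ∀ i, c i ≤ B := by
  choose g hg hg' using fun (i j : ι) (h : i ≤ j) => hc h
  let X : Set Ω := ⋃ i, (c i).carrier
  have hrep : ∀ (n : ℕ) (x : Fin n → X), ∃ (i : ι) (y : Fin n → (c i).carrier),
      ∀ k, (y k : Ω) = x k := by
    intro n x
    choose idx hidx using fun k => Set.mem_iUnion.1 (x k).2
    obtain ⟨i, hi⟩ := Finite.exists_le idx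
    exact ⟨i, fun k => g _ _ (hi k) ⟨x k, hidx k⟩, fun k => hg' _ _ _ _⟩
  choose idx rep hrep using hrep
  let sX : L.Structure X :=
    { funMap := fun {n} F x => ⟨(Structure.funMap F (rep n x) : (c (idx n x)).carrier),
        Set.mem_iUnion.2 ⟨_, Subtype.property _⟩⟩
      RelMap := fun {n} R x => Structure.RelMap R (rep n x) }
  have hcomp : ∀ (n : ℕ) (x : Fin n → X) (i : ι) (y : Fin n → (c i).carrier),
      (∀ k, (y k : Ω) = x k) →
      g i (max i (idx n x)) (le_max_left _ _) ∘ y =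
        g (idx n x) (max i (idx n x)) (le_max_right _ _) ∘ rep n x := by
    intro n x i y hy
    funext k
    refine Subtype.ext ?_
    rw [Function.comp_apply, Function.comp_apply, hg', hg', hy, hrep]
  let e : ∀ i, (c i).carrier ↪[L] X := fun i =>
    { toFun := fun a => ⟨a, Set.mem_iUnion.2 ⟨i, a.2⟩⟩
      inj' := fun a b hab => Subtype.ext (Subtype.mk.inj hab)
      map_fun' := by
        intro n F y
        refine Subtype.ext ?_
        have h := congrArg (Structure.funMap F) (hcomp n (fun k => ⟨y k, Set.mem_iUnion.2
          ⟨i, (y k).2⟩⟩) i y fun k => rfl)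
        rw [← Embedding.map_fun, ← Embedding.map_fun] at h
        have h' := congrArg Subtype.val h
        rw [hg', hg'] at h'
        exact h'
      map_rel' := by
        intro n R y
        have h := congrArg (Structure.RelMap R) (hcomp n (fun k => ⟨y k, Set.mem_iUnion.2
          ⟨i, (y k).2⟩⟩) i y fun k => rfl)
        rw [eq_iff_iff, Embedding.map_rel, Embedding.map_rel] at h
        exact h.symm }
  obtain ⟨hX, he⟩ := isStrong_of_chain (K := K) (fun i => (c i).isModel) e
    (fun x => by
      obtain ⟨i, hi⟩ := Set.mem_iUnion.1 x.2
      exact ⟨i, ⟨x, hi⟩, rfl⟩)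
    (fun i j hij => ⟨g i j hij.le, hg _ _ _, fun a => Subtype.ext (hg' _ _ _ _)⟩)
  refine ⟨⟨X, sX, hX, ?_⟩, rfl, fun i => ⟨e i, he i, fun a => rfl⟩⟩
  refine (mk_iUnion_le _).trans ((mul_le_mul' hι (ciSup_le' fun i => (c i).card_le)).trans ?_)
  exact (mul_eq_self hκ).le

/-- Transport of a model along an injection into `Ω`. -/
theorem exists_of_injective {Q : Type u} [L.Structure Q] (hQ : K.IsModel Q) (hcard : #Q ≤ κ)
    (j : Q → Ω) (hj : Function.Injective j) :
    ∃ (B : K.PlacedModel Ω κ) (e : Q ≃[L] B.carrier), ∀ q, (e q : Ω) = j q := by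
  let : L.Structure (Set.range j) := (Equiv.ofInjective j hj).inducedStructure
  let e : Q ≃[L] Set.range j := (Equiv.ofInjective j hj).inducedStructureEquiv
  refine ⟨⟨Set.range j, inferInstance,
    isModel_of_elementaryEmbedding' e.toElementaryEmbedding hQ, mk_range_le.trans hcard⟩, e, ?_⟩
  intro q
  rfl

/-- Extensions of cardinality at most `κ` can be realized in `Ω`. -/
theorem exists_ge (hκ : ℵ₀ ≤ κ) (hΩ : κ < #Ω) (A : K.PlacedModel Ω κ) {Q : Type u}
    [L.Structure Q] {g : A.carrier ↪[L] Q} (hg : K.IsStrong g) (hcard : #Q ≤ κ) :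
    ∃ (B : K.PlacedModel Ω κ) (e : Q ≃[L] B.carrier), A ≤ B ∧ ∀ a, (e (g a) : Ω) = a := by
  classical
  -- Since `κ < #Ω`, there is room outside `A` for the new points of `Q`; points of the form `g a`
  -- go back to `a`.
  have h1 : #((Set.range g)ᶜ : Set Q) ≤ #(A.carrierᶜ : Set Ω) := by
    by_contra! h
    have h2 : #(A.carrierᶜ : Set Ω) ≤ κ := h.le.trans ((mk_set_le _).trans hcard)
    have h3 := add_le_of_le hκ A.card_le h2
    rw [mk_sum_compl] at h3
    exact absurd h3 (not_le.2 hΩ)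
  obtain ⟨t⟩ := h1
  let j : Q → Ω := fun q => if h : ∃ a, g a = q then h.choose.1 else (t ⟨q, h⟩).1
  have hjg : ∀ a, j (g a) = a := by
    intro a
    have h : ∃ a', g a' = g a := ⟨a, rfl⟩
    simp only [j, dif_pos h]
    rw [g.injective h.choose_spec]
  have hjt : ∀ q (h : ¬ ∃ a, g a = q), j q = t ⟨q, h⟩ := fun q h => dif_neg h
  have hj : Function.Injective j := by
    intro p q hpq
    by_cases hp : ∃ a, g a = p
    · obtain ⟨a, rfl⟩ := hp
      by_cases hq : ∃ a, g a = q
      · obtain ⟨b, rfl⟩ := hq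
        rw [hjg, hjg] at hpq
        rw [Subtype.ext hpq]
      · rw [hjg, hjt q hq] at hpq
        exact ((t ⟨q, hq⟩).2 (hpq ▸ a.2)).elim
    · by_cases hq : ∃ a, g a = q
      · obtain ⟨b, rfl⟩ := hq
        rw [hjg, hjt p hp] at hpq
        exact ((t ⟨p, hp⟩).2 (hpq ▸ b.2)).elim
      · rw [hjt p hp, hjt q hq] at hpq
        exact congrArg Subtype.val (t.injective (Subtype.ext hpq))
  obtain ⟨B, e, he⟩ := exists_of_injective (K := K) (κ := κ) hg.isModel_right hcard j hj
  have he' : ∀ a, (e (g a) : Ω) = a := fun a => (he _).trans (hjg a)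
  exact ⟨B, e, ⟨e.toEmbedding.comp g, hg.comp (isStrong_of_equiv e hg.isModel_right), he'⟩, he'⟩

variable [Countable L.Symbols]

/-- All morphisms from small models to `A` are extended in a strong extension of `A`. -/
theorem exists_ge_forall_extension {c : Cardinal.{u}} (hc : c.IsInaccessible) (hΩ : c < #Ω)
    (A : K.PlacedModel Ω c) :
    ∃ B : K.PlacedModel Ω c, A ≤ B ∧ ∀ (M : Type u) [L.Structure M] (f : M ≃. A.carrier),
      K.IsMor f → #M < c →
      ∃ h : M ↪[L] B.carrier, K.IsStrong h ∧ ∀ m a, a ∈ f m → (h m : Ω) = a := by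
  classical
  have hc0 := hc.aleph0_lt.le
  -- Models smaller than `c` have copies on proper initial segments of `c`. Hence at most `c`
  -- extension problems have to be solved.
  let Task : Type u := Σ b : c.ord.ToType, L.Structure (Set.Iio b) × (Set.Iio b ≃. A.carrier)
  let Solved : Task → K.PlacedModel Ω c → Prop := fun t B =>
    letI := t.2.1
    K.IsMor t.2.2 → ∃ h : Set.Iio t.1 ↪[L] B.carrier, K.IsStrong h ∧
      ∀ m a, a ∈ t.2.2 m → (h m : Ω) = a
  have hTask : #Task ≤ c := by
    have h1 : #c.ord.ToType = c := by simp
    rw [mk_sigma]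
    refine (sum_le_mk_mul_iSup _).trans ?_
    rw [h1]
    refine (mul_le_mul' le_rfl (ciSup_le' fun b => ?_)).trans (mul_eq_self hc0).le
    rw [mk_prod, lift_id, lift_id]
    exact (mul_le_mul' (mk_structure_lt hc L (mk_Iio_ord_lt b)).le
      (mk_pequiv_le hc (mk_Iio_ord_lt b) A.card_le)).trans (mul_eq_self hc0).le
  have hmono : ∀ t B B', B ≤ B' → Solved t B → Solved t B' := by
    rintro t B B' ⟨g, hg, hg'⟩ h ht
    let := t.2.1
    obtain ⟨h, hh, hh'⟩ := h ht
    exact ⟨g.comp h, hh.comp hg, fun m a ha => (hg' _).trans (hh' m a ha)⟩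
  -- One problem is solved by amalgamating and placing the amalgam in `Ω`. If the premises fail, `B`
  -- is kept, which makes the step total on all placed models.
  have hsolve : ∀ t B, ∃ B', B ≤ B' ∧ (A ≤ B → Solved t B') := by
    intro t B
    let := t.2.1
    by_cases h : A ≤ B ∧ K.IsMor t.2.2
    · obtain ⟨⟨g, hg, hg'⟩, hf⟩ := h
      obtain ⟨Q, _, i, k, hi, hk, hQ, hik⟩ := exists_amalgam hc0 (K.comp hf hg)
        (mk_Iio_ord_lt t.1).le B.card_le
      obtain ⟨B', e, hBB', he⟩ := exists_ge hc0 hΩ B hi hQ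
      refine ⟨B', hBB', fun _ _ => ⟨e.toEmbedding.comp k,
        hk.comp (isStrong_of_equiv e hk.isModel_right), fun m a ha => ?_⟩⟩
      have := hik m (g a) ((PEquiv.mem_trans _ _ _ _).2 ⟨a, ha, mem_ofInj.2 rfl⟩)
      change (e (k m) : Ω) = a
      rw [this, he, hg']
    · exact ⟨B, le_rfl, fun h1 h2 => (h ⟨h1, h2⟩).elim⟩
  choose step hstep hstep' using hsolve
  let : LinearOrder Task := linearOrderOfSTO WellOrderingRel
  have : WellFoundedLT Task := ⟨WellOrderingRel.isWellOrder.wf⟩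
  obtain ⟨N, hN, hAN, hNstep⟩ := exists_transfinite_chain A
    (fun i d hne hd => by
      obtain ⟨B, -, hB⟩ := exists_union hc0 ((mk_set_le (Set.Iio i)).trans hTask) d hd
      exact ⟨B, hB⟩) step hstep
  have hfinal : ∃ B, A ≤ B ∧ ∀ t, Solved t B := by
    by_cases hne : Nonempty Task
    · obtain ⟨B, -, hB⟩ := exists_union hc0 hTask N hN
      refine ⟨B, (hAN hne.some).trans (hB _), fun t => hmono t _ _ (hB t) ?_⟩
      obtain ⟨q, hq, -, hqt⟩ := hNstep t
      rw [hqt]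
      exact hstep' t q hq
    · exact ⟨A, le_rfl, fun t => (hne ⟨t⟩).elim⟩
  obtain ⟨B, hAB, hB⟩ := hfinal
  refine ⟨B, hAB, fun M _ f hf hM => ?_⟩
  obtain ⟨b, ⟨e⟩⟩ := exists_equiv_Iio c hM
  let : L.Structure (Set.Iio b) := e.inducedStructure
  let e' : M ≃[L] Set.Iio b := e.inducedStructureEquiv
  have he' := isStrong_of_equiv e' (K.isModel_of_isMor hf).1
  obtain ⟨h, hh, hh'⟩ := hB
    ⟨b, inferInstance, (ofInj e'.toEmbedding e'.toEmbedding.injective).symm.trans f⟩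
    (K.comp (K.symm he') hf)
  refine ⟨h.comp e'.toEmbedding, he'.comp hh, fun m a ha => hh' (e' m) a ?_⟩
  refine (PEquiv.mem_trans _ _ _ _).2 ⟨m, ?_, ha⟩
  rw [PEquiv.mem_iff_mem]
  exact mem_ofInj.2 rfl

end PlacedModel

end AmalgamationClass

/-! ### Existence of rich models -/

section Union

open Cardinal

variable {L : FirstOrder.Language.{0, 0}} {U V : Type u}

/-- The union of a chain of partial maps. -/
theorem exists_pequiv_union {ι : Type*} [LinearOrder ι] (d : ι → (U ≃. V)) (hd : Monotone d) :
    ∃ h : U ≃. V, ∀ a b, b ∈ h a ↔ ∃ i, b ∈ d i a := by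
  refine exists_pequiv_of_rel _ ?_ ?_
  · rintro a b b' ⟨i, hi⟩ ⟨j, hj⟩
    exact mem_unique (hd (le_max_left i j) _ _ hi) (hd (le_max_right i j) _ _ hj)
  · rintro a a' b ⟨i, hi⟩ ⟨j, hj⟩
    exact (d (max i j)).inj (hd (le_max_left i j) _ _ hi) (hd (le_max_right i j) _ _ hj)

theorem isElementaryMap_union [L.Structure U] [L.Structure V] {ι : Type*} [LinearOrder ι]
    [Nonempty ι] {d : ι → (U ≃. V)} (hd : Monotone d) (he : ∀ i, IsElementaryMap L (d i))
    {h : U ≃. V} (hh : ∀ a b, b ∈ h a ↔ ∃ i, b ∈ d i a) : IsElementaryMap L h := by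
  intro n φ x y hxy
  choose idx hidx using fun k => (hh _ _).1 (hxy k)
  obtain ⟨i, hi⟩ := Finite.exists_le idx
  exact he i n φ x y fun k => hd (hi k) _ _ (hidx k)

end Union

namespace AmalgamationClass

open Cardinal

variable {L : FirstOrder.Language.{0, 0}} {K : AmalgamationClass.{u} L}
variable {M N U V : Type u} [L.Structure M] [L.Structure N] [L.Structure U] [L.Structure V]

variable (K) in
/-- All morphisms to `U` from models of cardinality less than `c` extend to total morphisms. -/
def IsRichBelow (c : Cardinal.{u}) (U : Type u) [L.Structure U] : Prop :=
  K.IsModel U ∧ ∀ (M : Type u) [L.Structure M] (f : M ≃. U), K.IsMor f → #M < c →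
    ∃ g : M ↪[L] U, K.IsStrong g ∧ ∀ a b, b ∈ f a → g a = b

variable {c : Cardinal.{u}}

theorem IsRichBelow.isFinitelyRich (hc : ℵ₀ < c) (hU : K.IsRichBelow c U) :
    K.IsFinitelyRich U :=
  ⟨hU.1, fun M _ f hf _ hM => hU.2 M f hf (hM.trans_lt hc)⟩

variable [Countable L.Symbols]

/-- The forth step for small instead of finite domains; the whole elementary substructure may serve
as the new domain, as it is still smaller than `c`. -/
theorem IsRichBelow.exists_extension (hc : ℵ₀ < c) (hV : K.IsRichBelow c V) {f : U ≃. V}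
    (hf : K.IsMor f) (hfc : #(domain f) < c) (a : U) :
    ∃ h : U ≃. V, K.IsMor h ∧ #(domain h) < c ∧ f ≤ h ∧ a ∈ domain h := by
  have := K.infinite (K.isModel_of_isMor hf).1
  have h1 : #(insert a (domain f) : Set U) ≤ max ℵ₀ #(domain f) :=
    mk_insert_le.trans (add_le_of_le (le_max_left _ _) (le_max_right _ _)
      (one_le_aleph0.trans (le_max_left _ _)))
  obtain ⟨S, hS, hScard⟩ := exists_elementarySubstructure_mk_le (L := L)
    (le_max_left ℵ₀ #(domain f)) _ h1
  have hSc : #S < c := hScard.trans_lt (max_lt hc hfc)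
  obtain ⟨h, hh, hle, hdom⟩ := exists_isMor_extension hf S ((Set.subset_insert _ _).trans hS)
    fun f' hf' _ => hV.2 S f' hf' hSc
  refine ⟨h, hh, ?_, hle, ?_⟩
  · rw [hdom]; exact hSc
  · rw [hdom]; exact hS (Set.mem_insert _ _)

/-- A small morphism between models that are rich below a regular cardinal extends to an
elementary embedding. -/
theorem IsRichBelow.exists_elementaryEmbedding (hc : ℵ₀ < c) (hreg : c.IsRegular)
    (hU : K.IsRichBelow c U) (hV : K.IsRichBelow c V) (hUc : #U ≤ c) {f : U ≃. V}
    (hf : K.IsMor f) (hfc : #(domain f) < c) :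
    ∃ g : U ↪ₑ[L] V, ∀ a b, b ∈ f a → g a = b := by
  have hfe := fun (h : U ≃. V) (hh : K.IsMor h) =>
    isElementaryMap_of_isFinitelyRich (hU.isFinitelyRich hc) (hV.isFinitelyRich hc) hh
  have := K.infinite hU.1
  -- Elementary maps are used because unions of chains of them are elementary, whereas no axiom
  -- makes a union of chains of partial morphisms a morphism. By K1 and back-and-forth the two
  -- notions coincide between `U` and `V`.
  let P := {h : U ≃. V // IsElementaryMap L h ∧ #(domain h) < c}
  have hcard : #c.ord.ToType = c := by simp
  have hne : Nonempty c.ord.ToType := by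
    rw [← mk_ne_zero_iff, hcard]
    exact hreg.ne_zero
  -- An enumeration of `U` along `c`, possibly with repetitions; step `i` puts `t i` into the
  -- domain.
  obtain ⟨t, ht⟩ : ∃ t : c.ord.ToType → U, Function.Surjective t := by
    rw [← hcard] at hUc
    obtain ⟨e⟩ := hUc
    exact ⟨_, Function.invFun_surjective e.injective⟩
  have hstep : ∀ (i : c.ord.ToType) (p : P), ∃ q : P, p ≤ q ∧ t i ∈ domain q.1 := by
    intro i p
    obtain ⟨h, hh, hhc, hle, hi⟩ := hV.exists_extension hc (K.elementary hU.1 hV.1 p.2.1) p.2.2 (t i)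
    exact ⟨⟨h, hfe h hh, hhc⟩, hle, hi⟩
  choose step hstep hstep' using hstep
  obtain ⟨D, hD, hfD, hDstep⟩ := exists_transfinite_chain (⟨f, hfe f hf, hfc⟩ : P)
    (fun i d _ hd => by
      have hd' : Monotone fun j => (d j).1 := fun j k hjk => hd hjk
      obtain ⟨h, hh⟩ := exists_pequiv_union _ hd'
      refine ⟨⟨h, isElementaryMap_union hd' (fun j => (d j).2.1) hh, ?_⟩,
        fun j a b hab => (hh _ _).2 ⟨j, hab⟩⟩
      have hdom : domain h = ⋃ j, domain (d j).1 := by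
        ext a
        rw [Set.mem_iUnion]
        exact ⟨fun ⟨b, hb⟩ => ((hh _ _).1 hb).imp fun j hj => ⟨b, hj⟩,
          fun ⟨j, b, hb⟩ => ⟨b, (hh _ _).2 ⟨j, hb⟩⟩⟩
      rw [hdom, card_iUnion_lt_iff_forall_of_isRegular hreg (mk_Iio_ord_lt i)]
      exact fun j => (d j).2.2) step hstep
  have hD' : Monotone fun j => (D j).1 := fun j k hjk => hD hjk
  obtain ⟨h, hh⟩ := exists_pequiv_union _ hD'
  obtain ⟨g, hg⟩ := (isElementaryMap_union hD' (fun j => (D j).2.1) hh).exists_elementaryEmbedding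
    (fun a => by
      obtain ⟨i, rfl⟩ := ht a
      obtain ⟨q, -, -, hq⟩ := hDstep i
      obtain ⟨b, hb⟩ := hstep' i q
      rw [← hq] at hb
      exact ⟨b, (hh _ _).2 ⟨i, hb⟩⟩)
  exact ⟨g, fun a b hab => mem_unique (hg a) ((hh _ _).2 ⟨hne.some, hfD _ _ _ hab⟩)⟩

/-- Every model of cardinality at most `c` has a strong extension that is rich below `c`. -/
theorem exists_isRichBelow (hc : c.IsInaccessible) (hM : K.IsModel M) (hMc : #M ≤ c) :
    ∃ (U : Type u) (_ : L.Structure U) (g : M ↪[L] U),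
      K.IsStrong g ∧ K.IsRichBelow c U ∧ #U ≤ c := by
  have hc0 := hc.aleph0_lt.le
  -- A universe with more than `c` points always leaves room for extensions of size `c`.
  let Ω : Type u := Set c.ord.ToType
  have hcard : #c.ord.ToType = c := by simp
  have hΩ : c < #Ω := by
    rw [mk_set, hcard]
    exact cantor c
  have hne : Nonempty c.ord.ToType := by
    rw [← mk_ne_zero_iff, hcard]
    exact hc.ne_zero
  obtain ⟨j⟩ : #M ≤ #Ω := hMc.trans hΩ.le
  obtain ⟨A, e, -⟩ := PlacedModel.exists_of_injective hM hMc j j.injective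
  choose step hstep hstep' using
    fun B : K.PlacedModel Ω c => B.exists_ge_forall_extension hc hΩ
  obtain ⟨D, hD, hAD, hDstep⟩ := exists_transfinite_chain A
    (fun i d hne hd => by
      obtain ⟨B, -, hB⟩ := PlacedModel.exists_union hc0
        (mk_Iio_ord_lt i).le d hd
      exact ⟨B, hB⟩) (fun (_ : c.ord.ToType) => step) fun _ => hstep
  obtain ⟨B, hBcar, hB⟩ := PlacedModel.exists_union hc0 hcard.le D hD
  obtain ⟨g, hg, -⟩ := (hAD hne.some).trans (hB hne.some)
  refine ⟨B.carrier, inferInstance, g.comp e.toEmbedding, (isStrong_of_equiv e hM).comp hg,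
    ⟨B.isModel, fun Q _ f hf hQ => ?_⟩, B.card_le⟩
  have hidx : ∀ x : Q, ∃ i, ∀ b, b ∈ f x → (b : Ω) ∈ (D i).carrier := by
    intro x
    by_cases h : ∃ b, b ∈ f x
    · obtain ⟨b, hb⟩ := h
      have hb' : (b : Ω) ∈ ⋃ i, (D i).carrier := hBcar ▸ b.2
      obtain ⟨i, hi⟩ := Set.mem_iUnion.1 hb'
      exact ⟨i, fun b' hb' => mem_unique hb hb' ▸ hi⟩
    · exact ⟨hne.some, fun b hb => (h ⟨b, hb⟩).elim⟩
  choose idx hidx using hidx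
  -- By regularity the range of `f` appears before some stage `i`, hence inside `q`; the extension
  -- problem is then solved in `step q`, which is `D i`.
  obtain ⟨i, hi⟩ := exists_forall_lt_of_isRegular hc.isRegular hQ idx
  obtain ⟨q, -, hDq, hqi⟩ := hDstep i
  obtain ⟨k, hk, hk'⟩ : q ≤ B := ((hstep q).trans hqi.ge).trans (hB i)
  obtain ⟨h, hh, hh'⟩ := hstep' q Q (f.trans (ofInj k k.injective).symm) (K.comp hf (K.symm hk)) hQ
  obtain ⟨l, hl, hl'⟩ : step q ≤ B := hqi.ge.trans (hB i)
  refine ⟨l.comp h, hh.comp hl, fun x b hb => Subtype.ext ?_⟩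
  obtain ⟨m, -, hm⟩ := hDq _ (hi x)
  let b' : q.carrier := m ⟨b, hidx x b hb⟩
  have hb' : (b' : Ω) = b := hm _
  refine (hl' _).trans ((hh' x b' ?_).trans hb')
  refine (PEquiv.mem_trans _ _ _ _).2 ⟨b, hb, ?_⟩
  rw [PEquiv.mem_iff_mem]
  exact mem_ofInj.2 (Subtype.ext ((hk' _).trans hb'))

/-- Only `#M = c` is new. Then `M` is strong in some `N` that is rich below `c`, the given map is a
small morphism from `N`, and it extends to an elementary embedding of `N` in `U`. -/
theorem IsRichBelow.isRich (hc : c.IsInaccessible) (hU : K.IsRichBelow c U) (hUc : #U ≤ c) :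
    K.IsRich U := by
  refine ⟨hU.1, fun M _ f hf hfM hM => ?_⟩
  suffices h : ∃ g : M ↪[L] U, K.IsStrong g ∧ ∀ a b, b ∈ f a → g a = b by
    obtain ⟨g, hg, hgf⟩ := h
    exact ⟨_, hg, isTotal_ofInj _ _, fun a b hab => mem_ofInj.2 (hgf a b hab)⟩
  rcases (hM.trans hUc).lt_or_eq with hlt | heq
  · exact hU.2 M f hf hlt
  obtain ⟨N, _, i, hi, hN, hNc⟩ := exists_isRichBelow hc (K.isModel_of_isMor hf).1 heq.le
  have hdom : #(domain ((ofInj i i.injective).symm.trans f)) < c := by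
    rw [← heq]
    refine lt_of_le_of_lt ?_ hfM
    have hsub : domain ((ofInj i i.injective).symm.trans f) ⊆ i '' domain f := by
      rintro a ⟨b, hb⟩
      obtain ⟨m, hm, hmb⟩ := (PEquiv.mem_trans _ _ _ _).1 hb
      rw [PEquiv.mem_iff_mem] at hm
      exact ⟨m, ⟨b, hmb⟩, mem_ofInj.1 hm⟩
    exact (mk_le_mk_of_subset hsub).trans mk_image_le
  obtain ⟨g, hg⟩ := hN.exists_elementaryEmbedding hc.aleph0_lt hc.isRegular hU hNc
    (K.comp (K.symm hi) hf) hdom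
  refine ⟨g.toEmbedding.comp i, hi.comp (isStrong_of_elementaryEmbedding g hU.1), fun a b hab => ?_⟩
  refine hg (i a) b ((PEquiv.mem_trans _ _ _ _).2 ⟨a, ?_, hab⟩)
  rw [PEquiv.mem_iff_mem]
  exact mem_ofInj.2 rfl

/-- Every model of cardinality at most an inaccessible cardinal is a strong submodel of a rich
model. -/
theorem exists_isRich (hc : c.IsInaccessible) (hM : K.IsModel M) (hMc : #M ≤ c) :
    ∃ (U : Type u) (_ : L.Structure U) (g : M ↪[L] U), K.IsStrong g ∧ K.IsRich U := by
  obtain ⟨U, _, g, hg, hU, hUc⟩ := exists_isRichBelow hc hM hMc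
  exact ⟨U, inferInstance, g, hg, hU.isRich hc hUc⟩

end AmalgamationClass

/-! ### Embedding a structure in an ultraproduct -/

section Embeddings

variable {L : FirstOrder.Language.{0, 0}} {M N : Type u} [L.Structure M] [L.Structure N]

/-- A map that preserves quantifier-free formulas is an embedding. -/
theorem exists_embedding_of_isQF (g : M → N)
    (h : ∀ (n : ℕ) (φ : L.Formula (Fin n)), φ.IsQF → ∀ x, φ.Realize (g ∘ x) ↔ φ.Realize x) :
    ∃ e : M ↪[L] N, ∀ a, e a = g a := by
  have hg : Function.Injective g := by
    intro a b hab
    have := h 2 ((Term.var 0).equal (Term.var 1)) (BoundedFormula.IsAtomic.equal _ _).isQF ![a, b]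
    simp only [Formula.realize_equal, Term.realize_var, Function.comp_apply] at this
    exact this.1 hab
  have hpe : IsPartialEmbedding L (ofInj g hg) := by
    intro n φ hφ x y hxy
    have : y = g ∘ x := funext fun i => (mem_ofInj.1 (hxy i)).symm
    rw [this, h n φ hφ]
  obtain ⟨e, he⟩ := hpe.exists_embedding (isTotal_ofInj g hg)
  exact ⟨e, fun a => (mem_ofInj.1 (he a)).symm⟩

/-- If every finite subset of `M` lies in an elementary substructure that embeds in a model of
`T`, then `M` embeds in a model of `T`. -/
theorem exists_embedding_of_finset {T : L.Theory} [Nonempty M]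
    (h : ∀ s : Finset M, ∃ (S : L.ElementarySubstructure M) (U : Type u) (_ : L.Structure U),
      (s : Set M) ⊆ S ∧ U ⊨ T ∧ Nonempty (S ↪[L] U)) :
    ∃ (N : Type u) (_ : L.Structure N), N ⊨ T ∧ Nonempty (M ↪[L] N) := by
  classical
  choose S U sU hS hU hg using h
  have hne : ∀ s, Nonempty (U s) := fun s => ⟨(hg s).some (Classical.arbitrary (S s))⟩
  -- Every finite subset of `M` is contained in almost all `s`, so the arbitrary values of `G`
  -- outside `S s` do not matter.
  let F : Ultrafilter (Finset M) := Ultrafilter.of Filter.atTop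
  let G : M → ∀ s, U s := fun m s =>
    if h : m ∈ S s then (hg s).some ⟨m, h⟩ else Classical.arbitrary (U s)
  refine ⟨(F : Filter (Finset M)).Product U, inferInstance, ⟨fun φ hφ => ?_⟩, ?_⟩
  · rw [Ultraproduct.sentence_realize]
    exact Filter.Eventually.of_forall fun s => (hU s).realize_of_mem φ hφ
  obtain ⟨e, -⟩ := exists_embedding_of_isQF (L := L) (M := M)
    (fun m => ((G m : ∀ s, U s) : (F : Filter (Finset M)).Product U)) (fun n φ hφ x => by
      have h1 := Ultraproduct.realize_formula_cast (u := F) φ (fun i => G (x i))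
      refine h1.trans ?_
      have h2 : ∀ᶠ s in (F : Filter (Finset M)), Finset.image x Finset.univ ≤ s :=
        Ultrafilter.of_le _ (Filter.eventually_ge_atTop _)
      have h3 : ∀ᶠ s in (F : Filter (Finset M)),
          ((φ.Realize fun i => G (x i) s) ↔ φ.Realize x) := by
        filter_upwards [h2] with s hs
        have hx : ∀ i, x i ∈ S s := fun i =>
          hS s (hs (Finset.mem_image_of_mem x (Finset.mem_univ i)))
        have hG : (fun i => G (x i) s) = (hg s).some ∘ fun i => ⟨x i, hx i⟩ := by
          funext i
          simp only [G, dif_pos (hx i), Function.comp_apply]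
        rw [hG]
        have h4 := (S s).subtype.map_formula φ (fun i => ⟨x i, hx i⟩)
        refine Iff.trans ?_ h4.symm
        have h5 := hφ.realize_embedding (hg s).some (v := fun i => (⟨x i, hx i⟩ : S s))
          (xs := default)
        rw [Formula.Realize, Formula.Realize, ← h5, Unique.eq_default ((hg s).some ∘ default)]
      rw [Filter.eventually_congr h3]
      exact Filter.eventually_const)
  exact ⟨e⟩

end Embeddings

/-! ### Saturation and realizations of types -/

section Saturation

open Cardinal

variable {L : FirstOrder.Language.{0, 0}} {M U : Type u} [L.Structure M] [L.Structure U]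

/-- A saturated structure realizes the types over `∅` of the elementarily equivalent
structures. -/
theorem IsSaturated.exists_realize_iff [Nonempty U] (hU : IsSaturated L U) [Nonempty M]
    (hUM : ∀ φ : L.Sentence, U ⊨ φ → M ⊨ φ) {n : ℕ} (a : Fin n → M) :
    ∃ b : Fin n → U, ∀ φ : L.Formula (Fin n), φ.Realize a ↔ φ.Realize b := by
  let A : Set U := ∅
  have hA : #A < #U := by
    rw [mk_eq_zero]
    exact pos_iff_ne_zero.2 (mk_ne_zero U)
  -- As `A` is empty there are no constants to interpret, and the theories with and without names
  -- for `A` amount to the same.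
  let : (constantsOn A).Structure M := constantsOn.structure fun x => x.2.elim
  have : M ⊨ L[[A]].completeTheory U := by
    refine ⟨fun ψ hψ => ?_⟩
    have : (LEquiv.addEmptyConstants L A).symm.toLHom.IsExpansionOn M :=
      LHom.sumElim_isExpansionOn _ _ _
    have h1 := LHom.realize_onSentence U (LEquiv.addEmptyConstants L A).symm.toLHom ψ
    have h2 := LHom.realize_onSentence M (LEquiv.addEmptyConstants L A).symm.toLHom ψ
    exact h2.1 (hUM _ (h1.2 hψ))
  obtain ⟨b, hb⟩ := hU A hA n ((L[[A]].completeTheory U).typeOf a)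
  refine ⟨b, fun φ => ?_⟩
  have := hb ((L.lhomWithConstants A).onFormula φ)
  rw [Theory.CompleteType.formula_mem_typeOf, LHom.realize_onFormula, LHom.realize_onFormula] at this
  exact this

/-- The structure given by a realization of a complete type. -/
theorem exists_realization {A : Set U} {n : ℕ}
    (p : (L[[A]].completeTheory U).CompleteType (Fin n)) {N : Type u}
    [L[[A]][[Fin n]].Structure N] (hN : N ⊨ (p : L[[A]][[Fin n]].Theory)) :
    ∃ (_ : L.Structure N) (k : A → N) (v : Fin n → N),
      (∀ φ : L.Formula A, φ.Realize k ↔ φ.Realize ((↑) : A → U)) ∧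
      ∀ φ : L[[A]].Formula (Fin n), Formula.equivSentence φ ∈ p ↔
        (BoundedFormula.constantsVarsEquiv φ).Realize (Sum.elim k v) (default : Fin 0 → N) := by
  let : L[[A]].Structure N := (L[[A]].lhomWithConstants (Fin n)).reduct N
  let sL : L.Structure N := (L.lhomWithConstants A).reduct N
  -- Because `p` is complete, its model `N` satisfies no sentences beyond those in `p`.
  have hp : ∀ ψ, ψ ∈ p ↔ N ⊨ ψ := by
    intro ψ
    refine ⟨fun h => hN.realize_of_mem ψ h, fun h => (p.mem_or_not_mem ψ).resolve_right fun h' => ?_⟩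
    exact (Sentence.realize_not N).1 (hN.realize_of_mem _ h') h
  have hT : N ⊨ L[[A]].completeTheory U :=
    ((L[[A]].lhomWithConstants (Fin n)).onTheory_model _).1 (hN.mono p.subset)
  refine ⟨sL, fun a => (L.con a : N), fun i => (L[[A]].con i : N), fun φ => ?_, fun φ => ?_⟩
  · rw [← Formula.realize_equivSentence N φ, realize_iff_of_model_completeTheory U N,
      Formula.realize_equivSentence U φ]
    simp only [coe_con]
  · rw [hp, Formula.realize_equivSentence]
    exact (BoundedFormula.realize_constantsVarsEquiv (M := N)).symm

end Saturation

namespace AmalgamationClass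

open Cardinal

/-! ### The theory of the rich models -/

variable {L : FirstOrder.Language.{0, 0}} {K : AmalgamationClass.{u} L} {T₀ : L.Theory}
variable {M N U V : Type u} [L.Structure M] [L.Structure N] [L.Structure U] [L.Structure V]

theorem IsRich.models_richTheory (hU : K.IsRich U) : U ⊨ K.richTheory :=
  ⟨fun _ hφ => hφ U hU⟩

theorem isModel_of_models_richTheory (hT₀ : K.IsAxiomatizedBy T₀) (hM : M ⊨ K.richTheory) :
    K.IsModel M :=
  (hT₀ M).2 (hM.mono fun φ hφ _ _ hU => ((hT₀ _).1 hU.1).realize_of_mem φ hφ)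

/-- Otherwise the negation of `φ` would belong to the rich theory. With
`models_richTheory_of_forall_exists`, this identifies the premise of fullness with `M ⊨
K.richTheory`. -/
theorem exists_isRich_of_realize (hM : M ⊨ K.richTheory) (φ : L.Sentence) (hφ : M ⊨ φ) :
    ∃ (U : Type u) (_ : L.Structure U), K.IsRich U ∧ U ⊨ φ := by
  by_contra! h
  have : φ.not ∈ K.richTheory := fun U _ hU => (Sentence.realize_not U).2 (h U _ hU)
  exact (Sentence.realize_not M).1 (hM.realize_of_mem _ this) hφ

theorem models_richTheory_of_forall_exists
    (h : ∀ φ : L.Sentence, M ⊨ φ → ∃ (U : Type u) (_ : L.Structure U), K.IsRich U ∧ U ⊨ φ) :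
    M ⊨ K.richTheory := by
  refine ⟨fun φ hφ => ?_⟩
  by_contra hM
  obtain ⟨U, _, hU, hUφ⟩ := h φ.not ((Sentence.realize_not M).2 hM)
  exact (Sentence.realize_not U).1 hUφ (hφ U hU)

/-- Under the condition #, embeddings between models of the theory of the rich models are
strong. -/
theorem isStrong_of_models_richTheory (hT₀ : K.IsAxiomatizedBy T₀) (hsharp : K.CondSharp)
    (hM : M ⊨ K.richTheory) (hN : N ⊨ K.richTheory) (f : M ↪[L] N) : K.IsStrong f := by
  have hS : f.toHom.range ⊨ K.richTheory :=
    (f.equivRange.toElementaryEmbedding.theory_model_iff _).1 hM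
  have h1 : K.IsStrong f.toHom.range.subtype := hsharp N f.toHom.range
    (isModel_of_models_richTheory hT₀ hN) (isModel_of_models_richTheory hT₀ hS) hN hS
  exact ((isStrong_of_equiv f.equivRange (isModel_of_models_richTheory hT₀ hM)).comp h1).congr
    fun _ => rfl

theorem modelsEmbedIn_of_richTheory (hT₀ : K.IsAxiomatizedBy T₀) :
    ModelsEmbedIn.{u} K.richTheory T₀ :=
  fun M _ _ hM => ⟨M, inferInstance, (hT₀ M).1 (isModel_of_models_richTheory hT₀ hM),
    ⟨Embedding.refl L M⟩⟩

/-- Two tuples with the same type are related by an elementary map. -/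
theorem exists_isElementaryMap {n : ℕ} (x : Fin n → M) (y : Fin n → N)
    (h : ∀ φ : L.Formula (Fin n), φ.Realize x ↔ φ.Realize y) :
    ∃ f : M ≃. N, IsElementaryMap L f ∧ ∀ i, y i ∈ f (x i) := by
  have heq : ∀ i j, x i = x j ↔ y i = y j := fun i j => by
    simpa only [Formula.realize_equal, Term.realize_var] using
      h ((Term.var i).equal (Term.var j))
  obtain ⟨f, hf⟩ := exists_pequiv_of_rel (fun a b => ∃ i, x i = a ∧ y i = b)
    (by
      rintro a b b' ⟨i, rfl, rfl⟩ ⟨j, hj, rfl⟩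
      exact ((heq _ _).1 hj).symm)
    (by
      rintro a a' b ⟨i, rfl, rfl⟩ ⟨j, rfl, hj⟩
      exact ((heq _ _).2 hj).symm)
  refine ⟨f, fun m φ x' y' hxy => ?_, fun i => (hf _ _).2 ⟨i, rfl, rfl⟩⟩
  choose σ hσ hσ' using fun i => (hf _ _).1 (hxy i)
  have := h (φ.relabel σ)
  rw [Formula.realize_relabel, Formula.realize_relabel] at this
  rwa [show x ∘ σ = x' from funext hσ, show y ∘ σ = y' from funext hσ'] at this

variable [Countable L.Symbols] {c : Cardinal.{u}}

/-- `M` may be larger than `c`, where no rich extension is available. Its countable elementary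
substructures do embed in rich models, and an ultraproduct of these receives `M`. -/
theorem modelsEmbedIn_richTheory (hc : c.IsInaccessible) (hT₀ : K.IsAxiomatizedBy T₀) :
    ModelsEmbedIn.{u} T₀ K.richTheory := by
  intro M _ _ hM
  have hM' := (hT₀ M).2 hM
  have := K.infinite hM'
  refine exists_embedding_of_finset fun s => ?_
  obtain ⟨S, hS, hScard⟩ := exists_elementarySubstructure_mk_le (L := L) le_rfl (s : Set M)
    (lt_aleph0_iff_set_finite.2 s.finite_toSet).le
  obtain ⟨U, _, g, hg, hU⟩ := exists_isRich hc (isModel_of_elementaryEmbedding S.subtype hM')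
    (hScard.trans hc.aleph0_lt.le)
  exact ⟨S, U, inferInstance, hS, hU.models_richTheory, ⟨g⟩⟩

/-! ### Model-completeness -/

/-- A realization `N` of `p` of size `#U` satisfies the rich theory. The map from the named elements
of `N` to `A` is elementary and small, so it extends to all of `N` by richness. Model-completeness
makes the extension elementary, and it carries the realization into `U`. -/
theorem IsRich.isSaturated (hT₀ : K.IsAxiomatizedBy T₀) (hmc : IsModelComplete.{u} K.richTheory)
    (hU : K.IsRich U) : IsSaturated L U := by
  intro A hA n p
  have hUinf := K.infinite hU.1
  have hrich : ∀ (N : Type u) [L.Structure N] (k : A → N),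
      (∀ φ : L.Formula A, φ.Realize k ↔ φ.Realize ((↑) : A → U)) → N ⊨ K.richTheory := by
    intro N _ k hk
    refine ⟨fun φ hφ => ?_⟩
    -- A sentence is a formula over `A` without actual variables, so `hk` covers it.
    have h1 := hk (φ.relabel Empty.elim)
    rw [Formula.realize_relabel, Formula.realize_relabel] at h1
    have h2 := hφ U hU
    rw [Sentence.Realize,
      Subsingleton.elim (default : Empty → U) ((Subtype.val : A → U) ∘ Empty.elim), ← h1] at h2
    rwa [Sentence.Realize, Subsingleton.elim (default : Empty → N) (k ∘ Empty.elim)]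
  obtain ⟨N, hNcard⟩ := Theory.exists_model_card_eq (T := (p : L[[A]][[Fin n]].Theory)) (by
      obtain ⟨N⟩ := p.isMaximal.1
      refine ⟨N, ?_⟩
      obtain ⟨_, k, v, hk, -⟩ := exists_realization p N.is_model
      exact K.infinite (isModel_of_models_richTheory hT₀ (hrich N k hk))) #U (aleph0_le_mk U) (by
      rw [card_withConstants, card_withConstants]
      have h1 : L.card ≤ ℵ₀ := mk_le_aleph0
      have h2 := aleph0_le_mk U
      simp only [lift_uzero, lift_id, mk_fin, lift_natCast]
      refine add_le_of_le h2 (add_le_of_le h2 ?_ hA.le) ((natCast_lt_aleph0).le.trans h2)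
      exact (lift_le_aleph0.2 h1).trans h2)
  obtain ⟨_, k, v, hk, hv⟩ := exists_realization p N.is_model
  have hNrich := hrich N k hk
  have hk' : ∀ a b, k a = k b ↔ a = b := fun a b => by
    have := hk ((Term.var a).equal (Term.var b))
    simpa only [Formula.realize_equal, Term.realize_var, Subtype.coe_inj] using this
  obtain ⟨f, hf⟩ := exists_pequiv_of_rel (fun (x : N) (y : U) => ∃ a : A, k a = x ∧ a = y)
    (by
      rintro x y y' ⟨a, rfl, rfl⟩ ⟨b, hb, rfl⟩
      rw [(hk' _ _).1 hb])
    (by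
      rintro x x' y ⟨a, rfl, rfl⟩ ⟨b, rfl, hb⟩
      rw [Subtype.ext hb])
  have hfe : IsElementaryMap L f := by
    intro m φ x y hxy
    choose σ hσ hσ' using fun i => (hf _ _).1 (hxy i)
    have := hk (φ.relabel σ)
    rw [Formula.realize_relabel, Formula.realize_relabel] at this
    rwa [show k ∘ σ = x from funext hσ, show (↑) ∘ σ = y from funext hσ'] at this
  have hdom : #(domain f) < #N := by
    rw [hNcard]
    refine lt_of_le_of_lt ?_ hA
    refine (mk_le_mk_of_subset (t := Set.range k) ?_).trans mk_range_le
    rintro x ⟨y, hy⟩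
    obtain ⟨a, ha, -⟩ := (hf _ _).1 hy
    exact ⟨a, ha⟩
  obtain ⟨h, hh, hht, hle⟩ := hU.2 N f
    (K.elementary (isModel_of_models_richTheory hT₀ hNrich) hU.1 hfe) hdom hNcard.le
  obtain ⟨g, -, hg⟩ := exists_isStrong hh hht
  obtain ⟨g', hg'⟩ := hmc N U hNrich hU.models_richTheory g
  have hgk : ∀ a, g' (k a) = a := fun a => by
    rw [hg']
    exact mem_unique (hg _) (hle _ _ ((hf _ _).2 ⟨a, rfl, rfl⟩))
  refine ⟨g' ∘ v, fun φ => ?_⟩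
  rw [hv, ← g'.map_boundedFormula, Sum.comp_elim, show g' ∘ k = (↑) from funext hgk,
    Unique.eq_default (g' ∘ default)]
  have := BoundedFormula.realize_constantsVarsEquiv (M := U) (φ := φ) (v := g' ∘ v)
    (xs := default)
  simp only [coe_con] at this
  exact this

/-- A countable elementary substructure of `M` embeds in a rich model. Both satisfy the rich theory,
so the embedding is elementary. -/
theorem isFull_of_isModelComplete (hc : c.IsInaccessible)
    (hmc : IsModelComplete.{u} K.richTheory) : K.IsFull := by
  intro M _ hM h
  have := K.infinite hM
  have hMrich := models_richTheory_of_forall_exists h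
  obtain ⟨S, -, hScard⟩ := exists_elementarySubstructure_mk_le (L := L) le_rfl (∅ : Set M)
    (by simp)
  obtain ⟨U, _, g, hg, hU⟩ := exists_isRich hc (isModel_of_elementaryEmbedding S.subtype hM)
    (hScard.trans hc.aleph0_lt.le)
  have := K.infinite hU.1
  obtain ⟨g', -⟩ := hmc S U ((S.theory_model_iff _).2 hMrich) hU.models_richTheory g
  refine ⟨U, inferInstance, hU, ⟨fun φ hφ => ?_⟩⟩
  rw [← g'.map_sentence, S.realize_sentence]
  exact hφ

/-- The types of `x` and of `f ∘ x` are realized in rich models `U` and `V`. The composite partial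
map from `U` through `M` and `N` to `V` is a morphism by #, hence elementary, so the two types
agree. -/
theorem isModelComplete_of_isSaturated_of_isFull (hT₀ : K.IsAxiomatizedBy T₀)
    (hsharp : K.CondSharp)
    (hsat : ∀ (U : Type u) [L.Structure U], K.IsRich U → IsSaturated L U) (hfull : K.IsFull) :
    IsModelComplete.{u} K.richTheory := by
  intro M N _ _ _ _ hM hN f
  have hf := isStrong_of_models_richTheory hT₀ hsharp hM hN f
  have key : ∀ (M : Type u) [L.Structure M] [Nonempty M], M ⊨ K.richTheory →
      ∀ (n : ℕ) (x : Fin n → M), ∃ (U : Type u) (_ : L.Structure U) (y : Fin n → U)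
        (g : M ≃. U), K.IsRich U ∧ IsElementaryMap L g ∧ ∀ i, y i ∈ g (x i) := by
    intro M _ _ hM n x
    obtain ⟨U, _, hU, hUM⟩ := hfull M (isModel_of_models_richTheory hT₀ hM)
      (exists_isRich_of_realize hM)
    have := K.infinite hU.1
    obtain ⟨y, hy⟩ := (hsat U hU).exists_realize_iff (M := M)
      (fun φ hφ => (realize_iff_of_model_completeTheory M U φ).1 hφ) x
    obtain ⟨g, hg, hg'⟩ := exists_isElementaryMap x y hy
    exact ⟨U, inferInstance, y, g, hU, hg, hg'⟩
  refine ⟨⟨f, fun n φ x => ?_⟩, fun _ => rfl⟩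
  obtain ⟨U, _, y, g, hU, hg, hxy⟩ := key M hM n x
  obtain ⟨V, _, z, h, hV, hh, hxz⟩ := key N hN n (f ∘ x)
  have hgm := K.elementary (isModel_of_models_richTheory hT₀ hM) hU.1 hg
  have hhm := K.elementary (isModel_of_models_richTheory hT₀ hN) hV.1 hh
  have hmor := K.comp (K.comp (K.symm hgm) hf) hhm
  have he := isElementaryMap_of_isFinitelyRich hU.isFinitelyRich hV.isFinitelyRich hmor
  have hyz : ∀ i, z i ∈ ((g.symm.trans (ofInj f f.injective)).trans h) (y i) := fun i =>
    (PEquiv.mem_trans _ _ _ _).2 ⟨f (x i), (PEquiv.mem_trans _ _ _ _).2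
      ⟨x i, g.mem_iff_mem.2 (hxy i), mem_ofInj.2 rfl⟩, hxz i⟩
  exact ((hg n φ x y hxy).trans (he n φ y z hyz)).trans (hh n φ (f ∘ x) z hxz).symm |>.symm

end AmalgamationClass

namespace AmalgamationClass

open Cardinal

/-! ### Model companions -/

variable {L : FirstOrder.Language.{0, 0}} {K : AmalgamationClass.{u} L} {T₀ T : L.Theory}

variable (K) in
/-- `M` is countable and elementarily embeds in a rich model. -/
def IsCountableRichPart (M : Type u) [L.Structure M] : Prop :=
  #M ≤ ℵ₀ ∧ ∃ (V : Type u) (_ : L.Structure V), K.IsRich V ∧ Nonempty (M ↪ₑ[L] V)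

theorem IsCountableRichPart.isModel {M : Type u} [L.Structure M] (hM : K.IsCountableRichPart M) :
    K.IsModel M := by
  obtain ⟨-, V, _, hV, ⟨e⟩⟩ := hM
  exact isModel_of_elementaryEmbedding e hV.1

variable [Countable L.Symbols] {c : Cardinal.{u}}

theorem exists_embedding_of_modelsEmbedIn {T T' : L.Theory} (h : ModelsEmbedIn.{u} T T')
    {M : Type u} [L.Structure M] [Infinite M] (hM : M ⊨ T) (hMc : #M ≤ ℵ₀) :
    ∃ (N : Type u) (_ : L.Structure N), N ⊨ T' ∧ #N ≤ ℵ₀ ∧ Nonempty (M ↪[L] N) := by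
  obtain ⟨N, _, hN, ⟨g⟩⟩ := h M hM
  have : Infinite N := Infinite.of_injective g g.injective
  obtain ⟨S, hS, hScard⟩ := exists_elementarySubstructure_mk_le (L := L) le_rfl (Set.range g)
    (mk_range_le.trans hMc)
  obtain ⟨g', -⟩ := exists_codRestrict g S hS
  exact ⟨S, inferInstance, (S.theory_model_iff _).2 hN, hScard, ⟨g'⟩⟩

/-- Every countable extension of `M` that models a theory whose models embed in models of `T₀`
lies in an elementary extension of `M` of the same kind. -/
theorem IsCountableRichPart.exists_extension (hc : c.IsInaccessible)
    (hT₀ : K.IsAxiomatizedBy T₀) (hsharp : K.CondSharp) (hT : ModelsEmbedIn.{u} T T₀)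
    {M W : Type u} [L.Structure M] [L.Structure W] (hM : K.IsCountableRichPart M) (hW : W ⊨ T)
    (hWc : #W ≤ ℵ₀) (j : M ↪[L] W) :
    ∃ (M₁ : Type u) (_ : L.Structure M₁) (i : W ↪[L] M₁) (e : M ↪ₑ[L] M₁),
      K.IsCountableRichPart M₁ ∧ ∀ a, e a = i (j a) := by
  have hMm := hM.isModel
  obtain ⟨hMc, V, _, hV, ⟨e⟩⟩ := hM
  have := K.infinite hMm
  have : Infinite W := Infinite.of_injective j j.injective
  obtain ⟨N, _, hN, hNc, ⟨g⟩⟩ := exists_embedding_of_modelsEmbedIn hT hW hWc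
  have := K.infinite ((hT₀ N).2 hN)
  obtain ⟨Q, _, hQ, hQc, ⟨h⟩⟩ :=
    exists_embedding_of_modelsEmbedIn (modelsEmbedIn_richTheory hc hT₀) hN hNc
  obtain ⟨V₁, _, k, hk, hV₁⟩ := exists_isRich hc (isModel_of_models_richTheory hT₀ hQ)
    (hQc.trans hc.aleph0_lt.le)
  have := K.infinite hV₁.1
  let i : W ↪[L] V₁ := k.comp (h.comp g)
  have hMrich := (e.theory_model_iff _).2 hV.models_richTheory
  -- The single embeddings through `W` and `N` need not be morphisms, but both `M` and `Q` satisfy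
  -- the rich theory, so # applies to the composite `M → Q`.
  have hs : K.IsStrong (i.comp j) :=
    ((isStrong_of_models_richTheory hT₀ hsharp hMrich hQ ((h.comp g).comp j)).comp hk).congr
      fun _ => rfl
  have he := isStrong_of_elementaryEmbedding e hV.1
  -- `M` maps elementarily to `V`, and the partial map from `V` back to `M` and on to `V₁` is a
  -- morphism of rich models.
  have hel := (isElementaryMap_of_elementaryEmbedding e).trans
    (isElementaryMap_of_isFinitelyRich hV.isFinitelyRich hV₁.isFinitelyRich
      (K.comp (K.symm he) hs))
  have hmem : ∀ a, i (j a) ∈ ((ofInj e e.injective).trans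
      ((ofInj e.toEmbedding e.toEmbedding.injective).symm.trans
        (ofInj (i.comp j) (i.comp j).injective))) a := by
    intro a
    refine (PEquiv.mem_trans _ _ _ _).2 ⟨e a, mem_ofInj.2 rfl, (PEquiv.mem_trans _ _ _ _).2
      ⟨a, ?_, mem_ofInj.2 rfl⟩⟩
    rw [PEquiv.mem_iff_mem]
    exact mem_ofInj.2 rfl
  obtain ⟨e', he'⟩ := hel.exists_elementaryEmbedding fun a => ⟨_, hmem a⟩
  have he'' : ∀ a, e' a = i (j a) := fun a => mem_unique (he' a) (hmem a)
  obtain ⟨S, hS, hScard⟩ := exists_elementarySubstructure_mk_le (L := L) le_rfl (Set.range i)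
    (mk_range_le.trans hWc)
  obtain ⟨i', hi'⟩ := exists_codRestrict i S hS
  refine ⟨S, inferInstance, i', ⟨fun a => i' (j a), fun n φ x => ?_⟩,
    ⟨hScard, V₁, inferInstance, hV₁, ⟨S.subtype⟩⟩, fun _ => rfl⟩
  rw [← S.subtype.map_formula, ← e'.map_formula]
  have : (S.subtype ∘ (fun a => i' (j a)) ∘ x) = e' ∘ x :=
    funext fun l => (hi' _).trans (he'' _).symm
  rw [this]

/-- Countable parts of rich models are elementary in the models of a model companion. -/
theorem realize_iff_of_isModelCompanion (hc : c.IsInaccessible)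
    (hT₀ : K.IsAxiomatizedBy T₀) (hsharp : K.CondSharp) (hT : IsModelCompanion.{u} T T₀) {n m : ℕ}
    (φ : L.BoundedFormula (Fin n) m) {M W : Type u} [L.Structure M] [L.Structure W]
    (hM : K.IsCountableRichPart M) (hW : W ⊨ T) (hWc : #W ≤ ℵ₀) (j : M ↪[L] W) (v : Fin n → M)
    (xs : Fin m → M) : φ.Realize (j ∘ v) (j ∘ xs) ↔ φ.Realize v xs := by
  induction φ generalizing M W with
  | falsum => rfl
  | equal t₁ t₂ => exact (BoundedFormula.IsAtomic.equal t₁ t₂).isQF.realize_embedding j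
  | rel R ts => exact (BoundedFormula.IsAtomic.rel R ts).isQF.realize_embedding j
  | imp φ ψ ih₁ ih₂ =>
    rw [BoundedFormula.realize_imp, BoundedFormula.realize_imp, ih₁ hM hW hWc, ih₂ hM hW hWc]
  | all φ ih =>
    constructor
    · intro H a
      have := H (j a)
      rw [← Fin.comp_snoc] at this
      exact (ih hM hW hWc j v _).1 this
    -- Continue `M → W` to `M → W → M₁ → W₁`. The map `M → M₁` is elementary by construction, `W →
    -- W₁` by model-completeness of `T`, and the induction hypothesis for `M₁ → W₁` connects the two
    -- chains.
    · intro H w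
      obtain ⟨M₁, _, i, e, hM₁, he⟩ := hM.exists_extension hc hT₀ hsharp hT.2.2 hW hWc j
      have := K.infinite hM.isModel
      have := K.infinite hM₁.isModel
      obtain ⟨W₁, _, hW₁, hW₁c, ⟨j₁⟩⟩ := exists_embedding_of_modelsEmbedIn hT.2.1
        ((hT₀ M₁).1 hM₁.isModel) hM₁.1
      have : Nonempty W := ⟨w⟩
      have : Nonempty W₁ := ⟨j₁ (i w)⟩
      obtain ⟨g, hg⟩ := hT.1 W W₁ hW hW₁ (j₁.comp i)
      have h1 := (e.map_boundedFormula φ.all v xs).2 H (i w)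
      rw [← ih hM₁ hW₁ hW₁c j₁] at h1
      rw [← g.map_boundedFormula]
      have hx : g ∘ Fin.snoc (j ∘ xs) w = j₁ ∘ Fin.snoc (e ∘ xs) (i w) := by
        rw [Fin.comp_snoc, Fin.comp_snoc]
        congr 1
        · funext l
          simp [hg, he]
        · exact hg w
      have hv : g ∘ j ∘ v = j₁ ∘ e ∘ v := by
        funext l
        simp [hg, he]
      rwa [hx, hv]

/-- A countable elementary substructure of a rich model embeds in a countable model of `T`, and this
embedding reflects all formulas. -/
theorem mem_richTheory_of_models (hc : c.IsInaccessible) (hT₀ : K.IsAxiomatizedBy T₀)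
    (hsharp : K.CondSharp) (hT : IsModelCompanion.{u} T T₀) {φ : L.Sentence} (hφ : T ⊨ᵇ φ) :
    φ ∈ K.richTheory := by
  intro U _ hU
  have := K.infinite hU.1
  obtain ⟨S, -, hScard⟩ := exists_elementarySubstructure_mk_le (L := L) le_rfl (∅ : Set U)
    (by simp)
  have hS : K.IsCountableRichPart S := ⟨hScard, U, inferInstance, hU, ⟨S.subtype⟩⟩
  have := K.infinite hS.isModel
  obtain ⟨W, _, hW, hWc, ⟨j⟩⟩ := exists_embedding_of_modelsEmbedIn hT.2.1
    ((hT₀ S).1 hS.isModel) hScard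
  have : Nonempty W := ⟨j (Classical.arbitrary S)⟩
  have h1 := hφ.realize_sentence W
  rw [← S.realize_sentence]
  have h2 := realize_iff_of_isModelCompanion hc hT₀ hsharp hT
    (Formula.relabel (Empty.elim : Empty → Fin 0) φ) hS hW hWc j default default
  have h3 : ∀ (X : Type u) [L.Structure X] (v : Fin 0 → X) (xs : Fin 0 → X),
      BoundedFormula.Realize (Formula.relabel (Empty.elim : Empty → Fin 0) φ) v xs ↔ X ⊨ φ := by
    intro X _ v xs
    rw [Formula.boundedFormula_realize_eq_realize, Formula.realize_relabel,
      Sentence.Realize, Unique.eq_default (v ∘ Empty.elim)]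
  rw [h3, h3] at h2
  exact h2.1 h1

end AmalgamationClass

end InductiveAmalgamation

/-! ### The equivalences and uniqueness of the model companion -/

open InductiveAmalgamation in
theorem theorem5p3 (L : FirstOrder.Language.{0, 0}) [Countable L.Symbols]
    (hinacc : ∃ c : Cardinal.{u}, c.IsInaccessible)
    (K : AmalgamationClass.{u} L) (T₀ : L.Theory)
    (hT₀ : K.IsAxiomatizedBy T₀) (hsharp : K.CondSharp) :
    List.TFAE [
      IsModelComplete.{u} K.richTheory,
      IsModelCompanion.{u} K.richTheory T₀,
      (∀ (U : Type u) [L.Structure U], K.IsRich U → IsSaturated L U) ∧ K.IsFull] ∧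
    ∀ T : L.Theory, IsModelCompanion.{u} T T₀ →
      IsModelCompanion.{u} K.richTheory T₀ ∧ ∀ φ : L.Sentence, T ⊨ᵇ φ ↔ φ ∈ K.richTheory := by
  obtain ⟨c, hc⟩ := hinacc
  have hcomp : IsModelComplete.{u} K.richTheory → IsModelCompanion.{u} K.richTheory T₀ := fun h =>
    ⟨h, AmalgamationClass.modelsEmbedIn_richTheory hc hT₀,
      AmalgamationClass.modelsEmbedIn_of_richTheory hT₀⟩
  refine ⟨?_, fun T hT => ?_⟩
  · tfae_have 1 → 2 := hcomp
    tfae_have 2 → 1 := fun h => h.1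
    tfae_have 1 → 3 := fun h =>
      ⟨fun U _ hU => hU.isSaturated hT₀ h, AmalgamationClass.isFull_of_isModelComplete hc h⟩
    tfae_have 3 → 1 := fun h =>
      AmalgamationClass.isModelComplete_of_isSaturated_of_isFull hT₀ hsharp h.1 h.2
    tfae_finish
  · have hmem := fun {φ} => AmalgamationClass.mem_richTheory_of_models (φ := φ) hc hT₀ hsharp hT
    -- The rich theory is at least as strong as `T`, so it inherits model-completeness.
    have hmodels : ∀ (M : Type u) [L.Structure M], M ⊨ K.richTheory → M ⊨ T := fun M _ hM =>
      ⟨fun φ hφ => hM.realize_of_mem φ (hmem (Theory.models_sentence_of_mem hφ))⟩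
    have hmc : IsModelComplete.{u} K.richTheory := fun M N _ _ _ _ hM hN =>
      hT.1 M N (hmodels M hM) (hmodels N hN)
    refine ⟨hcomp hmc, fun φ => ⟨hmem, fun hφ => ?_⟩⟩
    rw [Theory.models_sentence_iff]
    intro W
    -- Consequence is tested on models in `Type`, while the companion hypotheses concern `Type u`.
    let W' := ULift.{u} W
    let : L.Structure W' := (Equiv.ulift.{u} (α := W)).symm.inducedStructure
    let E : W ≃[L] W' := (Equiv.ulift.{u} (α := W)).symm.inducedStructureEquiv
    have hW' : W' ⊨ T := (E.toElementaryEmbedding.theory_model_iff T).1 W.is_model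
    obtain ⟨N, _, hN, ⟨g⟩⟩ := hT.2.2 W' hW'
    have hne : Nonempty N := ⟨g (Classical.arbitrary W')⟩
    obtain ⟨Q, _, hQ, ⟨h⟩⟩ := (hcomp hmc).2.1 N hN
    have hne' : Nonempty Q := ⟨h (Classical.arbitrary N)⟩
    -- Both ends of `W' → N → Q` are models of `T`, so the composite is elementary and `φ` descends
    -- from `Q` to `W`.
    obtain ⟨e, -⟩ := hT.1 W' Q hW' (hmodels Q hQ) (h.comp g)
    rw [E.toElementaryEmbedding.map_sentence, e.map_sentence]
    exact hQ.realize_of_mem φ hφ
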